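/- **Setting.** Let $d\ge 1$, $T>0$, and let $\Omega\subset\mathbb{R}^d$ be open and bounded with $C^2$ boundary. Put $Q=(0,T)\times\Omega$, $Q^c=(0,T)\times\Omega^c$, $M=(0,T)\times\mathbb{R}^d$, $\Gamma=(0,T)\times\partial\Omega$. Let $f:\mathbb{R}\to\mathbb{R}^d$ be locally Lipschitz, and let $b:\mathbb{R}\to\mathbb{R}$ be locally Lipschitz and non-decreasing with weak derivative $b'\in BV_{\mathrm{loc}}(\mathbb{R})$. Let $u_0\in L^\infty(\Omega)$, and let $u^c:Q^c\to\mathbb{R}$ have an extension $\overline u^c\in (C^2\cap L^\infty)([0,T]\times\mathbb{R}^d)$. A symmetric Lévy measure is a Borel measure $\mu\ge0$ on $\mathbb{R}^d$ with $\mu(-A)=\mu(A)$ for all Borel $A$, $\mu(\{0\})=0$ and $\int(|z|^2\wedge1)\,d\mu(z)<\infty$. For such $\mu$ and $r>0$ let $$\mathcal{L}^{\ge r}[w](x)=\int_{|z|\ge r}\big(w(x+z)-w(x)\big)\,d\mu(z),\qquad \mathcal{L}^{<r}[\varphi](x)=\lim_{\epsilon\to0^+}\int_{\epsilon<|z|<r}\big(\varphi(x+z)-\varphi(x)\big)\,d\mu(z),$$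 and let $\mathcal{L}=\mathcal{L}^{<r}+\mathcal{L}^{\ge r}$. Write $a^+=\max\{a,0\}$, $a^-=(-a)^+$, $\mathrm{sgn}^\pm(a)=\pm1$ if $\pm a>0$ and $0$ otherwise, and $F^\pm(u,k)=\mathrm{sgn}^\pm(u-k)(f(u)-f(k))$. A function $u\in L^\infty(M)$ is an *entropy solution* of $$\partial_tu+\operatorname{div}f(u)=\mathcal{L}[b(u)]\ \text{in }Q,\qquad u=u^c\ \text{in }Q^c,\qquad u(0,\cdot)=u_0\ \text{in }\Omega$$ if $u=u^c$ a.e. in $Q^c$ and, for each choice of sign $\pm$, all $r>0$, all $k\in\mathbb{R}$ and all $0\le\varphi\in C_c^\infty([0,T)\times\mathbb{R}^d)$ with $(b(u^c)-b(k))^\pm\varphi=0$ in $Q^c$, $$-\int_Q\Big((u-k)^\pm\partial_t\varphi+F^\pm(u,k)\cdot\nabla\varphi\Big)dx\,dt-\int_Q\mathcal{L}^{\ge r}[b(u)]\,\mathrm{sgn}^\pm(u-k)\,\varphi\,dx\,dt-\int_M(b(u)-b(k))^\pm\mathcal{L}^{<r}[\varphi]\,dx\,dt$$ $$\le\int_\Omega(u_0-k)^\pm\varphi(0,\cdot)\,dx+L_f\int_\Gamma(\overline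 u^c-k)^\pm\varphi\,d\sigma(x)\,dt,$$ where $\sigma$ is the surface measure on $\partial\Omega$ and $L_f=L_f(R_k)$ is a Lipschitz constant of $f$ on $[-R_k,R_k]$, $R_k=\max\{|k|,\|u_0\|_{L^\infty(\Omega)},\|u^c\|_{L^\infty(Q^c)}\}$. Here $R\mapsto L_f(R)$ is a fixed choice of Lipschitz constants of $f$ on the intervals $[-R,R]$ (one may take a constant if $f$ is globally Lipschitz). **Statement.** Let $\mu$ and $\mu_n$ ($n\in\mathbb{N}$) be symmetric Lévy measures such that $$\int_{\mathbb{R}^d}(|z|^2\wedge1)\,d|\mu_n-\mu|(z)\to0\quad\text{as }n\to\infty,$$ and for each $n$ let $u_n$ be an entropy solution of the problem above with $\mathcal{L}$ replaced by the operator $\mathcal{L}_n$ of $\mu_n$ (the data $u_0,u^c$ do not depend on $n$). Let $\gamma_n=b(u_n)-b(\overline u^c)$ in $(0,T)\times\mathbb{R}^d$ and $\gamma_n=0$ in $(0,T)^c\times\mathbb{R}^d$. If $$\sup_n\|\gamma_n(\cdot,\cdot+h)-\gamma_n\|_{L^2(\mathbb{R}^{1+d})}\to0\quad\text{as }h\to0\text{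 in }\mathbb{R}^d,$$ then $$\sup_n\|\gamma_n(\cdot+\tau,\cdot)-\gamma_n\|_{L^2(\mathbb{R}^{1+d})}\to0\quad\text{as }\tau\to0,$$ and $(b(u_n))_{n\in\mathbb{N}}$ is precompact (has compact closure) in $L^2(Q)$. -/

import Mathlib

open MeasureTheory Set Filter Topology
open scoped ENNReal NNReal ContDiff

noncomputable section

namespace NonlocalCL

/-- The space `ℝ^d` with the Euclidean norm. -/
abbrev Space (d : ℕ) : Type := EuclideanSpace ℝ (Fin d)

/-- Space-time `ℝ^{1+d} = ℝ × ℝ^d`; `volume` on it is the product Lebesgue measure. -/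
abbrev SpaceTime (d : ℕ) : Type := ℝ × Space d

variable {d : ℕ}

/-- `Q = (0,T) × Ω`. -/
def cyl (T : ℝ) (Ω : Set (Space d)) : Set (SpaceTime d) := Ioo 0 T ×ˢ Ω

/-- `Q^c = (0,T) × Ω^c`. -/
def extCyl (T : ℝ) (Ω : Set (Space d)) : Set (SpaceTime d) := Ioo 0 T ×ˢ Ωᶜ

/-- `M = (0,T) × ℝ^d`. -/
def slab (d : ℕ) (T : ℝ) : Set (SpaceTime d) := Ioo 0 T ×ˢ univ

/-- The boundary of `Ω` is of class `C²`: near each boundary point, `Ω` is the sublevel set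
`{ψ < 0}` of a `C²` function `ψ` with non-vanishing gradient
(so the outward normal there is `∇ψ/|∇ψ|`). -/
def HasC2Boundary (Ω : Set (Space d)) : Prop :=
  ∀ x ∈ frontier Ω, ∃ (U : Set (Space d)) (ψ : Space d → ℝ),
    IsOpen U ∧ x ∈ U ∧ ContDiffOn ℝ 2 ψ U ∧ (∀ y ∈ U, fderiv ℝ ψ y ≠ 0) ∧
      Ω ∩ U = {y ∈ U | ψ y < 0}

/-- The weak derivative of the locally Lipschitz function `b` is in `BV_loc(ℝ)`. For locally
Lipschitz functions the weak derivative is the a.e. derivative, and a function of one variable is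
in `BV_loc` iff it agrees a.e. with a function of finite pointwise variation on every compact
interval. -/
def HasLocBVDeriv (b : ℝ → ℝ) : Prop :=
  ∃ g : ℝ → ℝ, LocallyBoundedVariationOn g univ ∧ ∀ᵐ s : ℝ, HasDerivAt b (g s) s

/-- `μ` is a symmetric Lévy measure on `ℝ^d`. -/
structure IsSymmLevy (μ : Measure (Space d)) : Prop where
  symm : μ.map (fun z => -z) = μ
  zero : μ {0} = 0
  lintegral_lt_top : ∫⁻ z, ENNReal.ofReal (min (‖z‖ ^ 2) 1) ∂μ < ⊤

/-- `∫ (|z|² ∧ 1) d|μ - ν|(z)` for symmetric Lévy measures `μ`, `ν`: the total variation of the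
signed measure `(|z|² ∧ 1) μ - (|z|² ∧ 1) ν`, a difference of two finite measures. -/
def levyDist (μ ν : Measure (Space d)) : ℝ≥0∞ :=
  SignedMeasure.totalVariation
    (μ.withDensityᵥ (fun z => min (‖z‖ ^ 2) 1) - ν.withDensityᵥ (fun z => min (‖z‖ ^ 2) 1)) univ

/-- `L^{≥ r}[w](x)`, the nonsingular part of the Lévy operator with measure `μ`. -/
def levyGE (μ : Measure (Space d)) (r : ℝ) (w : Space d → ℝ) (x : Space d) : ℝ :=
  ∫ z in {z : Space d | r ≤ ‖z‖}, (w (x + z) - w x) ∂μ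

/-- `L^{< r}[φ](x)`, the singular part of the Lévy operator with measure `μ`, as a principal value.
The limit exists for `φ ∈ C_c^∞(ℝ^d)` and symmetric Lévy measures `μ`. -/
def levyLT (μ : Measure (Space d)) (r : ℝ) (φ : Space d → ℝ) (x : Space d) : ℝ :=
  limUnder (𝓝[>] (0 : ℝ)) fun ε =>
    ∫ z in {z : Space d | ε < ‖z‖ ∧ ‖z‖ < r}, (φ (x + z) - φ x) ∂μ

/-- `a^+` for `σ = 1` and `a^-` for `σ = -1`, where `a^- = (-a)^+`. -/
def pm (σ a : ℝ) : ℝ := max (σ * a) 0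

/-- `sgn^+` for `σ = 1` and `sgn^-` for `σ = -1`: `sgn^±(a) = ±1` if `±a > 0`, and `0` otherwise. -/
def sgnpm (σ a : ℝ) : ℝ := if 0 < σ * a then σ else 0

/-- The semi-Kružkov entropy flux `F^±(u,k) = sgn^±(u-k) (f(u) - f(k))`, with `± = σ`. -/
def entFlux (f : ℝ → Space d) (σ u k : ℝ) : Space d := sgnpm σ (u - k) • (f u - f k)

/-- `0 ≤ φ ∈ C_c^∞([0,T) × ℝ^d)`: such functions are the restrictions of functions in
`C_c^∞((-∞,T) × ℝ^d)`, and nonnegativity is only required on `[0,T) × ℝ^d`. -/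
structure IsTest (T : ℝ) (φ : SpaceTime d → ℝ) : Prop where
  smooth : ContDiff ℝ ∞ φ
  compact : HasCompactSupport φ
  supp : tsupport φ ⊆ Iio T ×ˢ univ
  nonneg : ∀ p ∈ Ico 0 T ×ˢ (univ : Set (Space d)), 0 ≤ φ p

/-- `max {|k|, ‖u₀‖_{L^∞(Ω)}, ‖u^c‖_{L^∞(Q^c)}}`: the constant `k` and the data, hence (by the
maximum principle) the solution, take values in `[-R,R]` for this `R`. -/
def rangeBound (T : ℝ) (Ω : Set (Space d)) (u₀ : Space d → ℝ) (uc : SpaceTime d → ℝ) (k : ℝ) : ℝ :=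
  max |k| (max (eLpNorm u₀ ⊤ (volume.restrict Ω)).toReal
    (eLpNorm uc ⊤ (volume.restrict (extCyl T Ω))).toReal)

/-- `u ∈ L^∞(M)` is an entropy solution of
`∂_t u + div f(u) = L[b(u)]` in `Q`, `u = u^c` in `Q^c`, `u(0,·) = u₀` in `Ω`,
where `L` is the Lévy operator with measure `μ` and `ubar` is the extension of `u^c`.
For each `R`, `Lf R` is a Lipschitz constant of `f` on `[-R,R]` (constant in `R` if `f` is
globally Lipschitz); the surface measure `dσ` is the `(d-1)`-dimensional Hausdorff measure, with
the Euclidean normalization. -/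
structure IsEntropySolution (T : ℝ) (Ω : Set (Space d)) (f : ℝ → Space d) (Lf : ℝ → ℝ≥0)
    (b : ℝ → ℝ) (uc ubar : SpaceTime d → ℝ) (u₀ : Space d → ℝ) (μ : Measure (Space d))
    (u : SpaceTime d → ℝ) : Prop where
  memLp : MemLp u ⊤ (volume.restrict (slab d T))
  entropy : ∀ r : ℝ, 0 < r → ∀ k σ : ℝ, (σ = 1 ∨ σ = -1) → ∀ φ : SpaceTime d → ℝ, IsTest T φ →
    (∀ p ∈ extCyl T Ω, pm σ (b (uc p) - b k) * φ p = 0) →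
    -(∫ p in cyl T Ω, (pm σ (u p - k) * deriv (fun s => φ (s, p.2)) p.1
          + inner ℝ (entFlux f σ (u p) k) (gradient (fun y => φ (p.1, y)) p.2)))
      - (∫ p in cyl T Ω, levyGE μ r (fun y => b (u (p.1, y))) p.2 * sgnpm σ (u p - k) * φ p)
      - (∫ p in slab d T, pm σ (b (u p) - b k) * levyLT μ r (fun y => φ (p.1, y)) p.2)
    ≤ (∫ x in Ω, pm σ (u₀ x - k) * φ (0, x))
      + (Lf (rangeBound T Ω u₀ uc k) : ℝ) *
        ∫ t in Ioo 0 T, ∫ x in frontier Ω, pm σ (ubar (t, x) - k) * φ (t, x)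
          ∂(Measure.euclideanHausdorffMeasure (d - 1))
  exterior : ∀ᵐ p ∂(volume.restrict (extCyl T Ω)), u p = uc p

/-- `b(u) - b(ubar)` in `(0,T) × ℝ^d`, extended by zero to `ℝ^{1+d}`. -/
def gammaFun (T : ℝ) (b : ℝ → ℝ) (ubar u : SpaceTime d → ℝ) : SpaceTime d → ℝ :=
  (slab d T).indicator fun p => b (u p) - b (ubar p)

end NonlocalCL

end

/-! Regularity in time is extracted from the equation in a weak sense and upgraded by the assumed
regularity in space. For `k` beyond the range of `u` the entropy inequality is linear in `u`, and
its two signs together bound `∂ₜu` tested against products `θ(t) ψ(x)` with `ψ` smooth and supported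
in `Ω` (`IsEntropySolution.neg_mul_integral_le`). The bound is uniform in `n` because the solutions
share a sup bound, the maximum principle `IsEntropySolution.ae_abs_le`, and the masses `∫ (|z|² ∧ 1)
dμ_n` are bounded (`exists_levyMass_le`). Hence spatial averages of `u_n` at scale `δ` are Lipschitz
in time, with a constant `K` depending on `δ` but not on `n` or on the centre
(`exists_time_lipschitz_average`).

Since `b` is monotone, and Lipschitz on the range, the square of a time increment of `b(u)` is at
most `L` times its product with the increment of `u`. The extension `b(ubar)`, uniformly continuous
on compact sets, costs a small error (`sq_increment_le`). It remains to make the integral of this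
product small. Replace the increment of `u` by its average over spatial translations of length less
than `δ`. By a change of variables each translation falls on the increment of `γ`, where
equicontinuity in space controls it (`abs_pairing_sub_translate_le`), while the averaged increment
of `u` is at most `Kτ`. The strip near `∂Ω` where averages would leave `Ω`, and the end strips of
duration `τ`, have small measure. Fixing `δ` first and then `τ` small against `1/K` gives
`exists_integral_sq_time_translate_le`.

The `γ_n` are then equicontinuous in `L²` under all space-time translations, bounded, and supported
in `Q` up to null sets, so the Kolmogorov–Riesz argument applies (`exists_finite_net_of_translate`).
On `Q` one has `γ_i - γ_j = b(u_i) - b(u_j)` a.e., which transfers compactness to `b(u_n)`. -/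

namespace NonlocalCL

variable {d : ℕ}

/-! ### Lévy measures and bounds for the Lévy operator -/

/-- The mass `∫ (|z|² ∧ 1) dμ(z)` of a Lévy measure. -/
noncomputable def levyMass (μ : Measure (Space d)) : ℝ := ∫ z, min (‖z‖ ^ 2) 1 ∂μ

lemma levyMass_nonneg (μ : Measure (Space d)) : 0 ≤ levyMass μ :=
  integral_nonneg fun z => by positivity

lemma IsSymmLevy.integrable {μ : Measure (Space d)} (hμ : IsSymmLevy μ) :
    Integrable (fun z : Space d => min (‖z‖ ^ 2) 1) μ := by
  have hm : Continuous fun z : Space d => min (‖z‖ ^ 2) 1 := by fun_prop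
  refine ⟨hm.aestronglyMeasurable, ?_⟩
  rw [hasFiniteIntegral_iff_ofReal (Eventually.of_forall fun z => by positivity)]
  exact hμ.lintegral_lt_top

/-- The masses of `μs n` and `μ` differ by the value on the whole space of a signed measure, hence
by at most its total variation, which converges and so is bounded. Only this boundedness is drawn
from the convergence of the measures. -/
lemma exists_levyMass_le {μ : Measure (Space d)} (hμ : IsSymmLevy μ)
    {μs : ℕ → Measure (Space d)} (hμs : ∀ n, IsSymmLevy (μs n))
    (hlim : Tendsto (fun n => levyDist (μs n) μ) atTop (𝓝 0)) :
    ∃ M : ℝ, ∀ n, levyMass (μs n) ≤ M := by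
  have h1 : Tendsto (fun n => (levyDist (μs n) μ).toReal) atTop (𝓝 0) := by
    exact (ENNReal.tendsto_toReal ENNReal.zero_ne_top).comp hlim
  obtain ⟨C, hC⟩ := h1.bddAbove_range
  refine ⟨C + levyMass μ, fun n => ?_⟩
  have h2 := SignedMeasure.norm_le_totalVariation
    ((μs n).withDensityᵥ (fun z => min (‖z‖ ^ 2) 1) - μ.withDensityᵥ (fun z => min (‖z‖ ^ 2) 1)) univ
  rw [_root_.sub_apply, withDensityᵥ_apply (hμs n).integrable MeasurableSet.univ,
    withDensityᵥ_apply hμ.integrable MeasurableSet.univ] at h2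
  have h3 := hC ⟨n, rfl⟩
  simp only [Measure.restrict_univ] at h2
  have h4 := (le_abs_self _).trans h2
  simp only [levyMass, levyDist] at *
  change _ ≤ C at h3
  simp only [Measure.real] at h4
  linarith

lemma IsSymmLevy.measure_norm_gt_lt_top {μ : Measure (Space d)} (hμ : IsSymmLevy μ) {r : ℝ}
    (hr : 0 < r) : μ {z : Space d | r ≤ ‖z‖} < ⊤ := by
  have h := hμ.integrable.measure_ge_lt_top (ε := min (r ^ 2) 1) (by positivity)
  refine lt_of_le_of_lt (measure_mono fun z hz => ?_) h
  have hz : r ≤ ‖z‖ := hz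
  exact min_le_min_right _ (pow_le_pow_left₀ hr.le hz 2)

/-- The weight `|z|² ∧ 1` equals `1` on the jumps considered. The bound on `w` is asked only at
almost every landing point, which is what Fubini provides for a solution bounded a.e. -/
lemma abs_levyGE_le {μ : Measure (Space d)} (hμ : IsSymmLevy μ) {w : Space d → ℝ} {x : Space d}
    {B : ℝ} (hB : 0 ≤ B) (hx : |w x| ≤ B)
    (hw : ∀ᵐ z ∂(μ.restrict {z : Space d | 1 ≤ ‖z‖}), |w (x + z)| ≤ B) :
    |levyGE μ 1 w x| ≤ 2 * B * levyMass μ := by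
  have hm : MeasurableSet {z : Space d | 1 ≤ ‖z‖} := measurableSet_le measurable_const measurable_norm
  calc |levyGE μ 1 w x| ≤ ∫ z in {z : Space d | 1 ≤ ‖z‖}, 2 * B * min (‖z‖ ^ 2) 1 ∂μ := by
        rw [levyGE, ← Real.norm_eq_abs]
        refine norm_integral_le_of_norm_le (hμ.integrable.const_mul (2 * B)).integrableOn ?_
        filter_upwards [hw, ae_restrict_mem hm] with z hz h1
        have h1 : 1 ≤ ‖z‖ := h1
        rw [min_eq_right (by nlinarith), mul_one]
        exact (norm_sub_le _ _).trans (by simp only [Real.norm_eq_abs]; linarith)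
    _ ≤ ∫ z, 2 * B * min (‖z‖ ^ 2) 1 ∂μ :=
        setIntegral_le_integral (hμ.integrable.const_mul _)
          (Eventually.of_forall fun z => by positivity)
    _ = _ := by rw [integral_const_mul, levyMass]

lemma mul_levyGE_nonpos {μ : Measure (Space d)} {r σ : ℝ} {w : Space d → ℝ} {x : Space d}
    (hw : ∀ᵐ z ∂(μ.restrict {z : Space d | r ≤ ‖z‖}), σ * (w (x + z) - w x) ≤ 0) :
    σ * levyGE μ r w x ≤ 0 := by
  rw [levyGE, ← integral_const_mul]
  exact integral_nonpos_of_ae hw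

lemma levyLT_eq_zero {μ : Measure (Space d)} {r : ℝ} {φ : Space d → ℝ} {x : Space d}
    (h : ∀ z, ‖z‖ < r → φ (x + z) = φ x) : levyLT μ r φ x = 0 := by
  have : (fun ε : ℝ => ∫ z in {z : Space d | ε < ‖z‖ ∧ ‖z‖ < r}, (φ (x + z) - φ x) ∂μ) =
      fun _ => 0 := by
    funext ε
    have hm : MeasurableSet {z : Space d | ε < ‖z‖ ∧ ‖z‖ < r} :=
      (measurableSet_lt measurable_const measurable_norm).inter
        (measurableSet_lt measurable_norm measurable_const)
    rw [setIntegral_congr_fun hm (g := fun _ => 0) fun z hz => by simp [h z hz.2]]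
    simp
  rw [levyLT, this]
  exact tendsto_const_nhds.limUnder_eq

lemma IsSymmLevy.measurePreserving_neg {μ : Measure (Space d)} (hμ : IsSymmLevy μ) :
    MeasurePreserving (fun z : Space d => -z) μ μ := ⟨measurable_neg, hμ.symm⟩

/-- By symmetry of `μ`, first differences may be replaced by half the second differences. These are
`O(|z|²)`, hence integrable against `μ` near `0`, so the principal value is a limit by dominated
convergence. -/
lemma abs_levyLT_le {μ : Measure (Space d)} (hμ : IsSymmLevy μ) {φ : Space d → ℝ} {x : Space d}
    (hφ : Continuous φ) (hc : HasCompactSupport φ) {L : ℝ} (hL : 0 ≤ L)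
    (h : ∀ z, |φ (x + z) + φ (x - z) - 2 * φ x| ≤ L * ‖z‖ ^ 2) :
    |levyLT μ 1 φ x| ≤ L * levyMass μ := by
  obtain ⟨C, hC⟩ := hφ.bounded_above_of_compact_support hc
  set A : ℝ → Set (Space d) := fun ε => {z : Space d | ε < ‖z‖ ∧ ‖z‖ < 1} with hA
  have hAm : ∀ ε, MeasurableSet (A ε) := fun ε =>
    (measurableSet_lt measurable_const measurable_norm).inter
      (measurableSet_lt measurable_norm measurable_const)
  set D : Space d → ℝ := fun z => (1 / 2) * (φ (x + z) + φ (x - z) - 2 * φ x) with hD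
  have hDc : Continuous D := by fun_prop
  have hDb : ∀ z ∈ A 0, |D z| ≤ L * min (‖z‖ ^ 2) 1 := by
    intro z hz
    rw [min_eq_left (by nlinarith [hz.2, norm_nonneg z]), hD, abs_mul]
    have := h z
    have h0 := abs_nonneg (φ (x + z) + φ (x - z) - 2 * φ x)
    rw [abs_of_pos (by norm_num : (0:ℝ) < 1 / 2)]
    linarith
  have hint : ∀ ε, 0 < ε → ∀ g : Space d → ℝ, Continuous g → (∃ C, ∀ z, ‖g z‖ ≤ C) →
      IntegrableOn g (A ε) μ := by
    rintro ε hε g hg ⟨C', hC'⟩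
    refine Measure.integrableOn_of_bounded (M := C') ?_ hg.aestronglyMeasurable
      (Eventually.of_forall hC')
    exact ((measure_mono fun z hz => le_of_lt hz.1).trans_lt (hμ.measure_norm_gt_lt_top hε)).ne
  have heq : ∀ ε, 0 < ε → ∫ z in A ε, (φ (x + z) - φ x) ∂μ = ∫ z, (A ε).indicator D z ∂μ := by
    intro ε hε
    have hb : ∃ C, ∀ z, ‖φ (x + z) - φ x‖ ≤ C :=
      ⟨C + C, fun z => (norm_sub_le _ _).trans (add_le_add (hC _) (hC _))⟩
    have hb' : ∃ C, ∀ z, ‖φ (x - z) - φ x‖ ≤ C :=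
      ⟨C + C, fun z => (norm_sub_le _ _).trans (add_le_add (hC _) (hC _))⟩
    have h1 := hint ε hε (fun z => φ (x + z) - φ x) (by fun_prop) hb
    have h2 := hint ε hε (fun z => φ (x - z) - φ x) (by fun_prop) hb'
    have h3 : ∫ z in A ε, (φ (x - z) - φ x) ∂μ = ∫ z in A ε, (φ (x + z) - φ x) ∂μ := by
      have := hμ.measurePreserving_neg.setIntegral_preimage_emb
        (MeasurableEquiv.neg (Space d)).measurableEmbedding (fun z => φ (x + z) - φ x) (A ε)
      have hpre : (fun z : Space d => -z) ⁻¹' A ε = A ε := by ext z; simp [hA]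
      rw [hpre] at this
      simpa [sub_eq_add_neg] using this
    rw [integral_indicator (hAm ε)]
    have h4 : ∫ z in A ε, D z ∂μ = (1 / 2) * (∫ z in A ε, (φ (x + z) - φ x) ∂μ +
        ∫ z in A ε, (φ (x - z) - φ x) ∂μ) := by
      rw [← integral_add h1 h2, ← integral_const_mul]
      congr 1; funext z; simp only [hD]; ring
    rw [h4, h3]; ring
  have hbd : ∀ ε, 0 ≤ ε → ∀ z, ‖(A ε).indicator D z‖ ≤ L * min (‖z‖ ^ 2) 1 := by
    intro ε hε z
    by_cases hz : z ∈ A ε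
    · rw [indicator_of_mem hz]
      exact hDb z ⟨hε.trans_lt hz.1, hz.2⟩
    · rw [indicator_of_notMem hz, norm_zero]; positivity
  have hlim : Tendsto (fun ε => ∫ z, (A ε).indicator D z ∂μ) (𝓝[>] (0 : ℝ))
      (𝓝 (∫ z, (A 0).indicator D z ∂μ)) := by
    refine tendsto_integral_filter_of_dominated_convergence (fun z => L * min (‖z‖ ^ 2) 1)
      (Eventually.of_forall fun ε => (hDc.stronglyMeasurable.indicator (hAm ε)).aestronglyMeasurable)
      ?_ (hμ.integrable.const_mul L) (Eventually.of_forall fun z => ?_)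
    · filter_upwards [self_mem_nhdsWithin] with ε hε
      exact Eventually.of_forall (hbd ε (le_of_lt hε))
    -- Pointwise the integrand is eventually constant: for `z ≠ 0` once `ε < ‖z‖`, and `z = 0` lies
    -- in no `A ε` with `ε ≥ 0`.
    · refine tendsto_const_nhds.congr' ?_
      rcases eq_or_ne z 0 with rfl | hz
      · filter_upwards [self_mem_nhdsWithin] with ε hε
        have hε : 0 < ε := hε
        rw [indicator_of_notMem, indicator_of_notMem] <;> simp [hA, hε.le]
      · filter_upwards [Ioo_mem_nhdsGT (norm_pos_iff.2 hz)] with ε hε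
        by_cases h1 : ‖z‖ < 1
        · rw [indicator_of_mem, indicator_of_mem]
          exacts [⟨hε.2, h1⟩, ⟨norm_pos_iff.2 hz, h1⟩]
        · rw [indicator_of_notMem, indicator_of_notMem] <;> simp [hA, h1]
  have hlt : levyLT μ 1 φ x = ∫ z, (A 0).indicator D z ∂μ := by
    refine Tendsto.limUnder_eq (hlim.congr' ?_)
    filter_upwards [self_mem_nhdsWithin] with ε hε
    exact (heq ε hε).symm
  rw [hlt, levyMass, ← integral_const_mul]
  exact norm_integral_le_of_norm_le (hμ.integrable.const_mul L)
    (Eventually.of_forall (hbd 0 le_rfl))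

/-! ### Translations of null sets, cylinders and test functions -/

instance : (volume : Measure (SpaceTime d)).IsAddHaarMeasure :=
  inferInstanceAs ((volume : Measure ℝ).prod (volume : Measure (Space d))).IsAddHaarMeasure

/-- A property that holds almost everywhere in space-time holds at almost all points after
translation in space by almost every jump, whatever the jump measure. -/
lemma ae_ae_space_shift {p : SpaceTime d → Prop} (hp : ∀ᵐ q : SpaceTime d, p q)
    (ν : Measure (Space d)) [SFinite ν] : ∀ᵐ q : SpaceTime d, ∀ᵐ z ∂ν, p (q.1, q.2 + z) := by
  have hm : Measurable fun a : SpaceTime d × Space d => ((a.1.1, a.1.2 + a.2) : SpaceTime d) := by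
    fun_prop
  obtain ⟨N, hN, hNm, hN0⟩ := exists_measurable_superset_of_null (ae_iff.1 hp)
  have h0 : (volume.prod ν) ((fun a : SpaceTime d × Space d =>
      ((a.1.1, a.1.2 + a.2) : SpaceTime d)) ⁻¹' N) = 0 := by
    -- With `z` fixed, the slice is a translate of the null set `N`; this is why the jump measure
    -- plays no role.
    rw [Measure.prod_apply_symm (hm hNm)]
    refine (lintegral_congr fun z => ?_).trans lintegral_zero
    have h2 := measure_preimage_add_right (volume : Measure (SpaceTime d)) ((0, z) : SpaceTime d) N
    rw [hN0] at h2
    rw [← h2]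
    congr 1
    ext q
    simp [Prod.add_def]
  have h1 := Measure.ae_ae_of_ae_prod (measure_eq_zero_iff_ae_notMem.1 h0)
  filter_upwards [h1] with q hq
  filter_upwards [hq] with z hz
  by_contra hcon
  exact hz (hN hcon)

lemma ae_slab_ae_space_shift {T : ℝ} {p : SpaceTime d → Prop}
    (hp : ∀ᵐ q ∂(volume.restrict (slab d T)), p q) (ν : Measure (Space d)) [SFinite ν] :
    ∀ᵐ q ∂(volume.restrict (slab d T)), ∀ᵐ z ∂ν, p (q.1, q.2 + z) := by
  have hm : MeasurableSet (slab d T) := measurableSet_Ioo.prod MeasurableSet.univ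
  rw [ae_restrict_iff' hm] at hp ⊢
  filter_upwards [ae_ae_space_shift hp ν] with q hq hqs
  filter_upwards [hq] with z hz
  exact hz ⟨hqs.1, mem_univ _⟩

lemma measurableSet_slab (T : ℝ) : MeasurableSet (slab d T) :=
  measurableSet_Ioo.prod MeasurableSet.univ

lemma cyl_subset_slab (T : ℝ) (Ω : Set (Space d)) : cyl T Ω ⊆ slab d T :=
  prod_mono_right (subset_univ _)

lemma measurableSet_cyl (T : ℝ) {Ω : Set (Space d)} (hΩ : IsOpen Ω) : MeasurableSet (cyl T Ω) :=
  measurableSet_Ioo.prod hΩ.measurableSet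

lemma measurableSet_extCyl (T : ℝ) {Ω : Set (Space d)} (hΩ : IsOpen Ω) :
    MeasurableSet (extCyl T Ω) :=
  measurableSet_Ioo.prod hΩ.measurableSet.compl

lemma volume_cyl_lt_top (T : ℝ) {Ω : Set (Space d)} (hΩb : Bornology.IsBounded Ω) :
    volume (cyl T Ω) < ⊤ := by
  rw [cyl, Measure.volume_eq_prod, Measure.prod_prod]
  exact ENNReal.mul_lt_top measure_Ioo_lt_top hΩb.measure_lt_top

lemma pm_eq_zero {σ a : ℝ} (h : σ * a ≤ 0) : pm σ a = 0 := max_eq_right h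

lemma pm_nonneg (σ a : ℝ) : 0 ≤ pm σ a := le_max_right _ _

lemma mul_sub_map_nonpos {b : ℝ → ℝ} (hb : Monotone b) {σ x y : ℝ} (hσ : σ = 1 ∨ σ = -1)
    (h : σ * (x - y) ≤ 0) : σ * (b x - b y) ≤ 0 := by
  rcases hσ with rfl | rfl
  · have := hb (show x ≤ y by linarith); linarith
  · have := hb (show y ≤ x by linarith); linarith

lemma isTest_mul {T : ℝ} {θ : ℝ → ℝ} {χ : Space d → ℝ} (hθ : ContDiff ℝ ∞ θ)
    (hθc : HasCompactSupport θ) (hθT : tsupport θ ⊆ Iio T) (hθ0 : ∀ t ∈ Ico 0 T, 0 ≤ θ t)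
    (hχ : ContDiff ℝ ∞ χ) (hχc : HasCompactSupport χ) (hχ0 : ∀ x, 0 ≤ χ x) :
    IsTest T fun p : SpaceTime d => θ p.1 * χ p.2 := by
  have hsub : Function.support (fun p : SpaceTime d => θ p.1 * χ p.2) ⊆
      tsupport θ ×ˢ tsupport χ := by
    intro p hp
    have hp : θ p.1 * χ p.2 ≠ 0 := hp
    exact ⟨subset_tsupport _ (left_ne_zero_of_mul hp), subset_tsupport _ (right_ne_zero_of_mul hp)⟩
  have hts := closure_minimal hsub ((isClosed_tsupport θ).prod (isClosed_tsupport χ))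
  exact ⟨(hθ.comp contDiff_fst).mul (hχ.comp contDiff_snd),
    (hθc.isCompact.prod hχc.isCompact).of_isClosed_subset (isClosed_tsupport _) hts,
    fun p hp => ⟨hθT (hts hp).1, mem_univ _⟩, fun p hp => mul_nonneg (hθ0 _ hp.1) (hχ0 _)⟩

/-- A time cutoff which is non-increasing on `(0,T)` and decreases with slope `-1` in the middle. -/
lemma exists_decreasing_cutoff {T a : ℝ} (ha : 0 < a) (haT : a < T / 2) :
    ∃ θ : ℝ → ℝ, ContDiff ℝ ∞ θ ∧ HasCompactSupport θ ∧ tsupport θ ⊆ Iio T ∧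
      (∀ t ∈ Ico 0 T, 0 ≤ θ t) ∧ (∀ t ∈ Ioo 0 T, deriv θ t ≤ 0) ∧
      ∀ t ∈ Ioo 0 T, |t - T / 2| < a → deriv θ t = -1 := by
  obtain ⟨c, hac, hcT⟩ := exists_between haT
  let g : ContDiffBump (T / 2 : ℝ) := ⟨a, c, ha, hac⟩
  -- The primitive `G` below vanishes near `T` but is a nonzero constant for very negative times;
  -- `η`, equal to `1` on `[-1, T+1]`, makes the support compact without changing `G` on `(0,T)`.
  let η : ContDiffBump (T / 2 : ℝ) := ⟨T / 2 + 1, T / 2 + 2, by linarith, by linarith⟩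
  let G : ℝ → ℝ := fun t => ∫ s in t..T, g s
  have hGd : ∀ t, HasDerivAt G (-g t) t := fun t =>
    intervalIntegral.integral_hasDerivAt_left (g.continuous.intervalIntegrable _ _)
      (g.continuous.stronglyMeasurableAtFilter _ _) g.continuous.continuousAt
  have hGs : ContDiff ℝ ∞ G := by
    rw [contDiff_infty_iff_deriv]
    refine ⟨fun t => (hGd t).differentiableAt, ?_⟩
    rw [show deriv G = fun t => -g t from funext fun t => (hGd t).deriv]
    exact g.contDiff.neg
  have hG0 : ∀ t, T / 2 + c ≤ t → G t = 0 := by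
    intro t ht
    refine intervalIntegral.integral_zero_ae (Eventually.of_forall fun s hs => ?_)
    refine g.zero_of_le_dist ?_
    rw [Real.dist_eq]
    have h1 : min t T < s := hs.1
    have h2 : T / 2 + c ≤ min t T := le_min ht (by linarith)
    exact le_trans (by linarith) (le_abs_self _)
  have hη1 : ∀ t ∈ Ioo 0 T, η t = 1 := fun t ht => η.one_of_mem_closedBall (by
    rw [Metric.mem_closedBall, Real.dist_eq, abs_le]
    exact ⟨by linarith [ht.1, ht.2, show η.rIn = T / 2 + 1 from rfl],
      by linarith [ht.1, ht.2, show η.rIn = T / 2 + 1 from rfl]⟩)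
  have hder : ∀ t ∈ Ioo 0 T, deriv (fun t => η t * G t) t = -g t := by
    intro t ht
    have : (fun t => η t * G t) =ᶠ[𝓝 t] G := by
      filter_upwards [isOpen_Ioo.mem_nhds ht] with s hs
      rw [hη1 s hs, one_mul]
    rw [this.deriv_eq, (hGd t).deriv]
  refine ⟨fun t => η t * G t, η.contDiff.mul hGs, η.hasCompactSupport.mul_right, ?_, ?_, ?_, ?_⟩
  · refine (closure_minimal (t := Iic (T / 2 + c)) (fun t ht => ?_) isClosed_Iic).trans
      fun t ht => lt_of_le_of_lt ht (by linarith : T / 2 + c < T)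
    by_contra h
    exact ht (by simp [hG0 t (le_of_lt (not_le.1 h))])
  · intro t ht
    exact mul_nonneg η.nonneg (intervalIntegral.integral_nonneg ht.2.le fun s _ => g.nonneg)
  · intro t ht
    rw [hder t ht]
    exact neg_nonpos.2 g.nonneg
  · intro t ht h
    rw [hder t ht, g.one_of_mem_closedBall]
    exact (le_of_lt h : dist t (T / 2) ≤ a)

lemma gradient_mul_const_left (c : ℝ) {χ : Space d → ℝ} {x : Space d} (h : DifferentiableAt ℝ χ x) :
    gradient (fun y => c * χ y) x = c • gradient χ x := by
  have : fderiv ℝ (fun y => c * χ y) x = c • fderiv ℝ χ x := fderiv_const_mul h c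
  rw [gradient, this, map_smul, gradient]

lemma gradient_eq_zero_of_eventually_const {χ : Space d → ℝ} {x : Space d} {c : ℝ}
    (h : χ =ᶠ[𝓝 x] fun _ => c) : gradient χ x = 0 := by
  rw [gradient, h.fderiv_eq]
  simp

/-! ### Maximum principle -/

section MaximumPrinciple

variable {T : ℝ} {Ω : Set (Space d)} {f : ℝ → Space d} {Lf : ℝ → ℝ≥0} {b : ℝ → ℝ}
  {uc ubar : SpaceTime d → ℝ} {u₀ : Space d → ℝ} {μ : Measure (Space d)} {u : SpaceTime d → ℝ}

/-- One half of the maximum principle, away from the initial and final times. -/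
lemma IsEntropySolution.pm_eq_zero_of_abs_lt (hΩo : IsOpen Ω) (hΩb : Bornology.IsBounded Ω)
    (hbm : Monotone b) (hμ : IsSymmLevy μ) (hu : IsEntropySolution T Ω f Lf b uc ubar u₀ μ u)
    {σ k : ℝ} (hσ : σ = 1 ∨ σ = -1) (huc : ∀ p ∈ extCyl T Ω, σ * (uc p - k) ≤ 0)
    (hubar : ∀ p ∈ slab d T, σ * (ubar p - k) ≤ 0)
    (hu₀ : ∀ᵐ x ∂(volume.restrict Ω), σ * (u₀ x - k) ≤ 0) {a : ℝ} (ha : 0 < a) (haT : a < T / 2) :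
    ∀ᵐ p ∂(volume.restrict (cyl T Ω)), |p.1 - T / 2| < a → σ * (u p - k) ≤ 0 := by
  obtain ⟨θ, hθ, hθc, hθT, hθ0, hθd, hθ1⟩ := exists_decreasing_cutoff ha haT
  obtain ⟨D, hD0, hD⟩ : ∃ D > 0, ∀ x ∈ Ω, ‖x‖ ≤ D := hΩb.exists_pos_norm_le
  -- This `r` exceeds the diameter of `Ω`, so jumps of length at least `r` from `Ω` leave `Ω`. The
  -- cutoff `χ` is `1` on the `r`-neighbourhood of `Ω`, so shorter jumps from `Ω` do not see `φ`
  -- vary.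
  set r : ℝ := 2 * D + 1 with hr
  let χ : ContDiffBump (0 : Space d) := ⟨D + r, D + r + 1, by linarith, by linarith⟩
  have hχ1 : ∀ x, ‖x‖ ≤ D + r → χ x = 1 := fun x hx =>
    χ.one_of_mem_closedBall (by simpa [Metric.mem_closedBall, dist_zero_right] using hx)
  set φ : SpaceTime d → ℝ := fun p => θ p.1 * χ p.2 with hφ
  have htest : IsTest T φ := isTest_mul hθ hθc hθT hθ0 χ.contDiff χ.hasCompactSupport
    fun x => χ.nonneg
  have key := hu.entropy r (by linarith) k σ hσ φ htest fun p hp => by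
    rw [pm_eq_zero (mul_sub_map_nonpos hbm hσ (huc p hp)), zero_mul]
  have hext : ∀ᵐ p ∂(volume.restrict (slab d T)), p ∉ cyl T Ω → σ * (u p - k) ≤ 0 := by
    have h2 := (ae_restrict_iff' (measurableSet_extCyl T hΩo)).1 hu.exterior
    rw [ae_restrict_iff' (measurableSet_slab T)]
    filter_upwards [h2] with p hp hps hpc
    have hpe : p ∈ extCyl T Ω := ⟨hps.1, fun h => hpc ⟨hps.1, h⟩⟩
    rw [hp hpe]
    exact huc p hpe
  have h3 : ∫ p in slab d T, pm σ (b (u p) - b k) * levyLT μ r (fun y => φ (p.1, y)) p.2 = 0 := by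
    refine integral_eq_zero_of_ae ?_
    filter_upwards [hext, ae_restrict_mem (measurableSet_slab T)] with p hp hps
    by_cases hpc : p ∈ cyl T Ω
    · rw [levyLT_eq_zero, mul_zero]; · rfl
      intro z hz
      have h := hD _ hpc.2
      simp only [hφ]
      rw [hχ1 _ ((norm_add_le _ _).trans (by linarith)), hχ1 _ (by linarith)]
    · rw [pm_eq_zero (mul_sub_map_nonpos hbm hσ (hp hpc)), zero_mul]; rfl
  have h2 : ∫ p in cyl T Ω, levyGE μ r (fun y => b (u (p.1, y))) p.2 * sgnpm σ (u p - k) * φ p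
      ≤ 0 := by
    refine integral_nonpos_of_ae ?_
    have : IsFiniteMeasure (μ.restrict {z : Space d | r ≤ ‖z‖}) :=
      isFiniteMeasure_restrict.2 (hμ.measure_norm_gt_lt_top (by linarith)).ne
    have hsh := ae_slab_ae_space_shift hext (μ.restrict {z : Space d | r ≤ ‖z‖})
    filter_upwards [ae_restrict_of_ae_restrict_of_subset (cyl_subset_slab T Ω) hsh,
      ae_restrict_mem (measurableSet_cyl T hΩo)] with p hp hpc
    have hφ0 : 0 ≤ φ p := htest.nonneg p ⟨⟨hpc.1.1.le, hpc.1.2⟩, mem_univ _⟩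
    refine mul_nonpos_of_nonpos_of_nonneg ?_ hφ0
    rw [sgnpm]
    -- Where the sign is nonzero, `u p` lies strictly beyond `k`, while the landing point carries
    -- exterior data, which does not. Monotonicity of `b` then fixes the sign of each increment.
    split_ifs with hpos
    · rw [mul_comm]
      refine mul_levyGE_nonpos ?_
      have hm : MeasurableSet {z : Space d | r ≤ ‖z‖} :=
        measurableSet_le measurable_const measurable_norm
      filter_upwards [hp, ae_restrict_mem hm] with z hz hzr
      have hzr : r ≤ ‖z‖ := hzr
      have hout : ((p.1, p.2 + z) : SpaceTime d) ∉ cyl T Ω := by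
        intro hcon
        have h1 := hD _ hcon.2
        have h2 := hD _ hpc.2
        have h3 : ‖z‖ ≤ ‖p.2 + z‖ + ‖p.2‖ := by
          simpa using norm_sub_le (p.2 + z) p.2
        simp only at h1
        linarith
      have h4 := hz hout
      exact mul_sub_map_nonpos hbm hσ (by nlinarith)
    · simp
  have hJ1 : ∫ x in Ω, pm σ (u₀ x - k) * φ (0, x) = 0 := by
    refine integral_eq_zero_of_ae ?_
    filter_upwards [hu₀] with x hx
    rw [pm_eq_zero hx, zero_mul]; rfl
  have hJ2 : ∫ t in Ioo 0 T, ∫ x in frontier Ω, pm σ (ubar (t, x) - k) * φ (t, x)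
          ∂(Measure.euclideanHausdorffMeasure (d - 1)) = 0 := by
    refine setIntegral_eq_zero_of_forall_eq_zero fun t ht => ?_
    refine setIntegral_eq_zero_of_forall_eq_zero fun x _ => ?_
    rw [pm_eq_zero (hubar (t, x) ⟨ht, mem_univ _⟩), zero_mul]
  have h1 : ∫ p in cyl T Ω, (pm σ (u p - k) * deriv (fun s => φ (s, p.2)) p.1
          + inner ℝ (entFlux f σ (u p) k) (gradient (fun y => φ (p.1, y)) p.2)) =
        ∫ p in cyl T Ω, pm σ (u p - k) * deriv θ p.1 := by
    refine setIntegral_congr_fun (measurableSet_cyl T hΩo) fun p hp => ?_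
    have hx : (fun y => φ (p.1, y)) =ᶠ[𝓝 p.2] fun _ => θ p.1 := by
      filter_upwards [hΩo.mem_nhds hp.2] with y hy
      simp only [hφ]
      rw [hχ1 y (by linarith [hD y hy]), mul_one]
    simp only [gradient_eq_zero_of_eventually_const hx, inner_zero_right, add_zero]
    simp only [hφ]
    rw [hχ1 p.2 (by linarith [hD _ hp.2])]
    simp
  -- What remains is `-∫ (u-k)^± θ' ≤ ∫ L^{≥ r}[b(u)] sgn^±(u-k) φ ≤ 0`, whose left integrand is
  -- nonnegative; hence it vanishes a.e., and `θ' = -1` in the middle.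
  rw [h1, h3, hJ1, hJ2] at key
  have hle : ∀ p ∈ cyl T Ω, 0 ≤ -(pm σ (u p - k) * deriv θ p.1) := fun p hp => by
    have := mul_nonneg (pm_nonneg σ (u p - k)) (neg_nonneg.2 (hθd p.1 hp.1))
    linarith
  have hint : Integrable (fun p => -(pm σ (u p - k) * deriv θ p.1))
      (volume.restrict (cyl T Ω)) := by
    have : IsFiniteMeasure (volume.restrict (cyl T Ω)) :=
      isFiniteMeasure_restrict.2 (volume_cyl_lt_top T hΩb).ne
    have hu1 : MemLp u ⊤ (volume.restrict (cyl T Ω)) :=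
      hu.memLp.mono_measure (Measure.restrict_mono (cyl_subset_slab T Ω) le_rfl)
    have hu2 : MemLp (fun p => pm σ (u p - k)) ⊤ (volume.restrict (cyl T Ω)) := by
      have h4 : MemLp (fun p => σ * (u p - k)) ⊤ (volume.restrict (cyl T Ω)) :=
        (hu1.sub (memLp_const k)).const_mul σ
      exact h4.sup (memLp_const (0 : ℝ))
    obtain ⟨C, hC⟩ := (hθ.continuous_deriv (by simp)).bounded_above_of_compact_support hθc.deriv
    have h5 : MemLp (fun p : SpaceTime d => deriv θ p.1) ⊤ (volume.restrict (cyl T Ω)) :=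
      memLp_top_of_bound ((hθ.continuous_deriv (by simp)).comp continuous_fst).aestronglyMeasurable
        C (Eventually.of_forall fun p => hC _)
    exact ((hu2.integrable le_top).mul_of_top_left h5).neg
  have hzero : ∫ p in cyl T Ω, -(pm σ (u p - k) * deriv θ p.1) = 0 := by
    refine le_antisymm ?_ (setIntegral_nonneg (measurableSet_cyl T hΩo) hle)
    rw [integral_neg]
    linarith
  rw [setIntegral_eq_zero_iff_of_nonneg_ae
    (ae_restrict_of_forall_mem (measurableSet_cyl T hΩo) hle) hint] at hzero
  filter_upwards [hzero, ae_restrict_mem (measurableSet_cyl T hΩo)] with p hp hpc hpa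
  rw [hθ1 p.1 hpc.1 hpa] at hp
  have : pm σ (u p - k) = 0 := by simpa using hp
  exact max_eq_right_iff.1 this

/-- The maximum principle: solutions are bounded by the sup norm of the data. -/
theorem IsEntropySolution.ae_abs_le (hΩo : IsOpen Ω) (hΩb : Bornology.IsBounded Ω)
    (hbm : Monotone b) (hμ : IsSymmLevy μ) (hu : IsEntropySolution T Ω f Lf b uc ubar u₀ μ u)
    {C : ℝ} (huc : ∀ p ∈ extCyl T Ω, |uc p| ≤ C) (hubar : ∀ p ∈ slab d T, |ubar p| ≤ C)
    (hu₀ : ∀ᵐ x ∂(volume.restrict Ω), |u₀ x| ≤ C) :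
    ∀ᵐ p ∂(volume.restrict (slab d T)), |u p| ≤ C := by
  have aux : ∀ σ : ℝ, (σ = 1 ∨ σ = -1) →
      ∀ᵐ p ∂(volume.restrict (cyl T Ω)), σ * (u p - σ * C) ≤ 0 := by
    intro σ hσ
    have hsc : ∀ v, |v| ≤ C → σ * (v - σ * C) ≤ 0 := by
      intro v hv
      rw [abs_le] at hv
      rcases hσ with rfl | rfl <;> linarith
    -- The cutoff reaches only times with `|t - T/2| < a` for `a < T/2`, so `(0,T)` is exhausted by
    -- countably many such intervals.
    have hn : ∀ n : ℕ, ∀ᵐ p ∂(volume.restrict (cyl T Ω)),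
        |p.1 - T / 2| < T / 2 - 1 / ((n : ℝ) + 1) → σ * (u p - σ * C) ≤ 0 := by
      intro n
      rcases le_or_gt (T / 2 - 1 / ((n : ℝ) + 1)) 0 with h | h
      · exact Eventually.of_forall fun p hp => absurd (hp.trans_le h) (abs_nonneg _).not_gt
      · refine hu.pm_eq_zero_of_abs_lt hΩo hΩb hbm hμ hσ (fun p hp => hsc _ (huc p hp))
          (fun p hp => hsc _ (hubar p hp)) (hu₀.mono fun x hx => hsc _ hx) h ?_
        have : (0 : ℝ) < 1 / ((n : ℝ) + 1) := by positivity
        linarith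
    filter_upwards [ae_all_iff.2 hn, ae_restrict_mem (measurableSet_cyl T hΩo)] with p hp hpc
    have h1 : |p.1 - T / 2| < T / 2 := abs_lt.2 ⟨by linarith [hpc.1.1], by linarith [hpc.1.2]⟩
    obtain ⟨n, hn⟩ := exists_nat_one_div_lt (sub_pos.2 h1)
    exact hp n (by linarith)
  have h1 := aux 1 (Or.inl rfl)
  have h2 := aux (-1) (Or.inr rfl)
  have h3 := hu.exterior
  rw [ae_restrict_iff' (measurableSet_cyl T hΩo)] at h1 h2
  rw [ae_restrict_iff' (measurableSet_extCyl T hΩo)] at h3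
  rw [ae_restrict_iff' (measurableSet_slab T)]
  filter_upwards [h1, h2, h3] with p hp1 hp2 hp3 hps
  by_cases hx : p.2 ∈ Ω
  · have h4 := hp1 ⟨hps.1, hx⟩
    have h5 := hp2 ⟨hps.1, hx⟩
    exact abs_le.2 ⟨by linarith, by linarith⟩
  · rw [hp3 ⟨hps.1, hx⟩]
    exact huc p ⟨hps.1, hx⟩

end MaximumPrinciple

/-! ### Weak bound on the time derivative -/

section WeakEstimate

variable {T : ℝ} {Ω : Set (Space d)} {f : ℝ → Space d} {Lf : ℝ → ℝ≥0} {b : ℝ → ℝ}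
  {uc ubar : SpaceTime d → ℝ} {u₀ : Space d → ℝ} {μ : Measure (Space d)} {u : SpaceTime d → ℝ}

set_option maxHeartbeats 400000 in
/-- The weak time derivative of a solution, tested against a nonnegative product function, is
controlled by the `L¹` norm in time of the test function. -/
theorem IsEntropySolution.neg_mul_integral_le (hT : 0 < T) (hΩo : IsOpen Ω)
    (hΩb : Bornology.IsBounded Ω)
    (hf : Continuous f) (hμ : IsSymmLevy μ) (hu : IsEntropySolution T Ω f Lf b uc ubar u₀ μ u)
    {R F B : ℝ} (hR : 0 < R) (hB : 0 ≤ B) (huR : ∀ᵐ p ∂(volume.restrict (slab d T)), |u p| < R)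
    (hF : ∀ v w, |v| ≤ R → |w| ≤ R → ‖f v - f w‖ ≤ F) (hbB : ∀ v, |v| ≤ R → |b v| ≤ B)
    {ψ : Space d → ℝ} (hψ : ContDiff ℝ ∞ ψ) (hψc : HasCompactSupport ψ) (hψ0 : ∀ x, 0 ≤ ψ x)
    (hψΩ : ∀ x ∉ Ω, ψ x = 0) {P G L δ : ℝ} (hL : 0 ≤ L) (hP : ∀ x, ψ x ≤ P)
    (hG : ∀ x, ‖fderiv ℝ ψ x‖ ≤ G)
    (hψL : ∀ x z, |ψ (x + z) + ψ (x - z) - 2 * ψ x| ≤ L * ‖z‖ ^ 2)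
    {x₀ : Space d} (hψδ : ∀ x, δ ≤ ‖x - x₀‖ → ψ x = 0)
    {θ : ℝ → ℝ} (hθ : ContDiff ℝ ∞ θ) (hθc : HasCompactSupport θ) (hθT : tsupport θ ⊆ Ioo 0 T)
    (hθ0 : ∀ t, 0 ≤ θ t) {σ : ℝ} (hσ : σ = 1 ∨ σ = -1) :
    -(σ * ∫ p in cyl T Ω, u p * (deriv θ p.1 * ψ p.2)) ≤
      ((F * G + 2 * B * levyMass μ * P) * volume.real Ω +
        2 * B * (L * levyMass μ) * volume.real (Metric.ball x₀ (1 + δ))) *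
        ∫ t in Ioo 0 T, θ t := by
  set m := levyMass μ with hm
  have hm0 : 0 ≤ m := levyMass_nonneg μ
  have hF0 : 0 ≤ F := (norm_nonneg _).trans (hF 0 0 (by simpa using hR.le) (by simpa using hR.le))
  have hG0 : 0 ≤ G := (norm_nonneg _).trans (hG 0)
  have hP0 : 0 ≤ P := (hψ0 0).trans (hP 0)
  -- For this `k`, beyond the range of `u`, `sgn^±(u-k)` is constantly `σ` and `(u-k)^± = σ(u-k)`:
  -- the entropy inequality is linear in `u`.
  set k : ℝ := -(σ * R) with hk
  have hσ1 : |σ| = 1 := by rcases hσ with rfl | rfl <;> simp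
  have hkR : |k| ≤ R := by rw [hk, abs_neg, abs_mul, hσ1, one_mul, abs_of_pos hR]
  have hvc := volume_cyl_lt_top T hΩb
  have huRc := ae_restrict_of_ae_restrict_of_subset (cyl_subset_slab T Ω) huR
  set φ : SpaceTime d → ℝ := fun p => θ p.1 * ψ p.2 with hφ
  have htest : IsTest T φ := isTest_mul hθ hθc (hθT.trans Ioo_subset_Iio_self) (fun t _ => hθ0 t)
    hψ hψc hψ0
  have key := hu.entropy 1 one_pos k σ hσ φ htest fun p hp => by
    simp only [hφ]
    rw [hψΩ _ hp.2, mul_zero, mul_zero]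
  have hθzero : ∀ t ∉ Ioo 0 T, θ t = 0 := fun t ht => image_eq_zero_of_notMem_tsupport
    fun h => ht (hθT h)
  have hJ1 : ∫ x in Ω, pm σ (u₀ x - k) * φ (0, x) = 0 := by
    simp only [hφ]
    rw [hθzero 0 (by simp)]
    simp
  have hJ2 : ∫ t in Ioo 0 T, ∫ x in frontier Ω, pm σ (ubar (t, x) - k) * φ (t, x)
          ∂(Measure.euclideanHausdorffMeasure (d - 1)) = 0 := by
    refine setIntegral_eq_zero_of_forall_eq_zero fun t ht => ?_
    refine setIntegral_eq_zero_of_forall_eq_zero fun x hx => ?_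
    rw [hΩo.frontier_eq] at hx
    simp only [hφ]
    rw [hψΩ x hx.2, mul_zero, mul_zero]
  have hpos : ∀ v, |v| < R → 0 < σ * (v - k) := by
    intro v hv
    rw [abs_lt] at hv
    rw [hk]
    rcases hσ with rfl | rfl <;> linarith
  have hθi : Integrable θ := hθ.continuous.integrable_of_hasCompactSupport hθc
  have hcylint : ∀ c : ℝ, ∫ p in cyl T Ω, θ p.1 * c = (∫ t in Ioo 0 T, θ t) * (c * volume.real Ω) := by
    intro c
    rw [cyl, Measure.volume_eq_prod, setIntegral_prod_mul (f := θ) (g := fun _ => c),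
      setIntegral_const, smul_eq_mul, mul_comm c]
  have hθcyl : ∀ c : ℝ, IntegrableOn (fun p : SpaceTime d => θ p.1 * c) (cyl T Ω) := by
    intro c
    obtain ⟨C, hC⟩ := hθ.continuous.bounded_above_of_compact_support hθc
    refine Measure.integrableOn_of_bounded (M := C * |c|) hvc.ne
      (((hθ.continuous.comp continuous_fst).mul continuous_const).aestronglyMeasurable)
      (Eventually.of_forall fun p => ?_)
    rw [norm_mul]
    exact mul_le_mul_of_nonneg_right (hC _) (norm_nonneg _)
  have hgrad : ∀ p : SpaceTime d, gradient (fun y => φ (p.1, y)) p.2 = θ p.1 • gradient ψ p.2 :=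
    fun p => gradient_mul_const_left (χ := ψ) (θ p.1) (hψ.differentiable (by simp) p.2)
  have hgradn : ∀ x, ‖gradient ψ x‖ ≤ G := fun x => by
    rw [gradient, LinearIsometryEquiv.norm_map]; exact hG x
  have hderiv : ∀ p : SpaceTime d, deriv (fun s => φ (s, p.2)) p.1 = deriv θ p.1 * ψ p.2 :=
    fun p => by simp [hφ]
  obtain ⟨Cθ, hCθ⟩ := (hθ.continuous_deriv (by simp)).bounded_above_of_compact_support hθc.deriv
  have hum : AEStronglyMeasurable u (volume.restrict (cyl T Ω)) :=
    hu.memLp.1.mono_measure (Measure.restrict_mono (cyl_subset_slab T Ω) le_rfl)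
  have hw : Continuous fun p : SpaceTime d => deriv θ p.1 * ψ p.2 :=
    ((hθ.continuous_deriv (by simp)).comp continuous_fst).mul (hψ.continuous.comp continuous_snd)
  have hwb : ∀ p : SpaceTime d, ‖deriv θ p.1 * ψ p.2‖ ≤ Cθ * P := fun p => by
    rw [norm_mul]
    refine mul_le_mul (hCθ _) ?_ (norm_nonneg _) ((norm_nonneg _).trans (hCθ 0))
    rw [Real.norm_of_nonneg (hψ0 _)]; exact hP _
  have hint1 : IntegrableOn (fun p : SpaceTime d => u p * (deriv θ p.1 * ψ p.2)) (cyl T Ω) := by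
    refine IntegrableOn.of_bound hvc (hum.mul hw.aestronglyMeasurable) (R * (Cθ * P)) ?_
    filter_upwards [huRc] with p hp
    rw [norm_mul]
    exact mul_le_mul hp.le (hwb p) (norm_nonneg _) hR.le
  have hint2 : IntegrableOn (fun p : SpaceTime d => deriv θ p.1 * ψ p.2) (cyl T Ω) :=
    Measure.integrableOn_of_bounded hvc.ne hw.aestronglyMeasurable (Eventually.of_forall hwb)
  set E : SpaceTime d → ℝ := fun p => inner ℝ (σ • (f (u p) - f k)) (θ p.1 • gradient ψ p.2) with hE
  have hEb : ∀ᵐ p ∂(volume.restrict (cyl T Ω)), ‖E p‖ ≤ θ p.1 * (F * G) := by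
    filter_upwards [huRc] with p hp
    refine (norm_inner_le_norm _ _).trans ?_
    rw [norm_smul, norm_smul, Real.norm_eq_abs, hσ1, one_mul, Real.norm_of_nonneg (hθ0 _)]
    have h1 := hF (u p) k hp.le hkR
    have h2 := hgradn p.2
    calc ‖f (u p) - f k‖ * (θ p.1 * ‖gradient ψ p.2‖)
        = θ p.1 * (‖f (u p) - f k‖ * ‖gradient ψ p.2‖) := by ring
      _ ≤ _ := mul_le_mul_of_nonneg_left (mul_le_mul h1 h2 (norm_nonneg _) hF0) (hθ0 _)
  have hEi : IntegrableOn E (cyl T Ω) := by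
    refine Integrable.mono' (hθcyl (F * G)) ?_ hEb
    have h1 : AEStronglyMeasurable (fun p => σ • (f (u p) - f k)) (volume.restrict (cyl T Ω)) :=
      ((hf.comp_aestronglyMeasurable hum).sub aestronglyMeasurable_const).const_smul σ
    have h2 : Continuous fun p : SpaceTime d => θ p.1 • gradient ψ p.2 := by
      refine (hθ.continuous.comp continuous_fst).smul ?_
      have : Continuous fun x => gradient ψ x :=
        (LinearIsometryEquiv.continuous _).comp (hψ.continuous_fderiv (by simp))
      exact this.comp continuous_snd
    exact h1.inner h2.aestronglyMeasurable
  have hI1 : ∫ p in cyl T Ω, (pm σ (u p - k) * deriv (fun s => φ (s, p.2)) p.1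
          + inner ℝ (entFlux f σ (u p) k) (gradient (fun y => φ (p.1, y)) p.2)) =
        σ * (∫ p in cyl T Ω, u p * (deriv θ p.1 * ψ p.2)) + ∫ p in cyl T Ω, E p := by
    -- The contribution of the constant `k` drops out because `θ` vanishes at both ends of `(0,T)`.
    have h0 : ∫ p in cyl T Ω, deriv θ p.1 * ψ p.2 = 0 := by
      have h1 : ∫ t in Ioo 0 T, deriv θ t = 0 := by
        rw [← integral_Ioc_eq_integral_Ioo, ← intervalIntegral.integral_of_le hT.le,
          intervalIntegral.integral_deriv_eq_sub (fun t _ => hθ.differentiable (by simp) t)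
            ((hθ.continuous_deriv (by simp)).intervalIntegrable _ _), hθzero T (by simp),
          hθzero 0 (by simp), sub_zero]
      rw [cyl, Measure.volume_eq_prod, setIntegral_prod_mul (f := deriv θ) (g := ψ), h1, zero_mul]
    have h2 : ∫ p in cyl T Ω, (pm σ (u p - k) * deriv (fun s => φ (s, p.2)) p.1
          + inner ℝ (entFlux f σ (u p) k) (gradient (fun y => φ (p.1, y)) p.2)) =
        ∫ p in cyl T Ω, (σ * (u p * (deriv θ p.1 * ψ p.2)) + (-(σ * k)) * (deriv θ p.1 * ψ p.2)
          + E p) := by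
      refine integral_congr_ae ?_
      filter_upwards [huRc] with p hp
      have h := hpos _ hp
      rw [hderiv, hgrad, entFlux, sgnpm, if_pos h, pm, max_eq_left h.le]
      simp only [hE]
      ring
    have h3 : IntegrableOn (fun p : SpaceTime d => σ * (u p * (deriv θ p.1 * ψ p.2))) (cyl T Ω) :=
      hint1.const_mul σ
    have h4 : IntegrableOn (fun p : SpaceTime d => -(σ * k) * (deriv θ p.1 * ψ p.2)) (cyl T Ω) :=
      hint2.const_mul _
    have h5 : IntegrableOn (fun p : SpaceTime d => σ * (u p * (deriv θ p.1 * ψ p.2)) +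
        -(σ * k) * (deriv θ p.1 * ψ p.2)) (cyl T Ω) := h3.add h4
    rw [h2, integral_add h5 hEi, integral_add h3 h4, integral_const_mul,
      integral_const_mul, h0, mul_zero, add_zero]
  have hI1' : |∫ p in cyl T Ω, E p| ≤ (∫ t in Ioo 0 T, θ t) * (F * G * volume.real Ω) := by
    rw [← hcylint]
    exact norm_integral_le_of_norm_le (hθcyl _) hEb
  have hI2 : |∫ p in cyl T Ω, levyGE μ 1 (fun y => b (u (p.1, y))) p.2 * sgnpm σ (u p - k) * φ p|
      ≤ (∫ t in Ioo 0 T, θ t) * (2 * B * m * P * volume.real Ω) := by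
    rw [← hcylint, ← Real.norm_eq_abs]
    refine norm_integral_le_of_norm_le (hθcyl _) ?_
    have : IsFiniteMeasure (μ.restrict {z : Space d | 1 ≤ ‖z‖}) :=
      isFiniteMeasure_restrict.2 (hμ.measure_norm_gt_lt_top one_pos).ne
    have hsh := ae_slab_ae_space_shift huR (μ.restrict {z : Space d | 1 ≤ ‖z‖})
    filter_upwards [ae_restrict_of_ae_restrict_of_subset (cyl_subset_slab T Ω) hsh, huRc]
      with p hp hpR
    have h1 : |levyGE μ 1 (fun y => b (u (p.1, y))) p.2| ≤ 2 * B * m :=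
      abs_levyGE_le hμ hB (hbB _ hpR.le) (hp.mono fun z hz => hbB _ hz.le)
    rw [sgnpm, if_pos (hpos _ hpR)]
    simp only [hφ, norm_mul, Real.norm_eq_abs, hσ1, mul_one, abs_of_nonneg (hθ0 _),
      abs_of_nonneg (hψ0 _)]
    calc |levyGE μ 1 (fun y => b (u (p.1, y))) p.2| * (θ p.1 * ψ p.2)
        = θ p.1 * (|levyGE μ 1 (fun y => b (u (p.1, y))) p.2| * ψ p.2) := by ring
      _ ≤ _ := mul_le_mul_of_nonneg_left (mul_le_mul h1 (hP _) (hψ0 _) (by positivity)) (hθ0 _)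
  have hI3 : |∫ p in slab d T, pm σ (b (u p) - b k) * levyLT μ 1 (fun y => φ (p.1, y)) p.2|
      ≤ (∫ t in Ioo 0 T, θ t) * (2 * B * (L * m) * volume.real (Metric.ball x₀ (1 + δ))) := by
    set c := 2 * B * (L * m) with hc
    have hc0 : 0 ≤ c := by positivity
    -- `ψ` lives within `δ` of `x₀` and the jumps are shorter than `1`, so the singular part
    -- vanishes outside this ball.
    set g : Space d → ℝ := (Metric.ball x₀ (1 + δ)).indicator fun _ => c with hg
    have hgi : Integrable g := (integrable_indicator_iff Metric.isOpen_ball.measurableSet).2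
      (integrableOn_const Metric.isBounded_ball.measure_lt_top.ne)
    have hval : ∫ p in slab d T, θ p.1 * g p.2 =
        (∫ t in Ioo 0 T, θ t) * (c * volume.real (Metric.ball x₀ (1 + δ))) := by
      rw [slab, Measure.volume_eq_prod, setIntegral_prod_mul (f := θ) (g := g), Measure.restrict_univ,
        hg, integral_indicator Metric.isOpen_ball.measurableSet, setIntegral_const, smul_eq_mul,
        mul_comm c]
    rw [← hval, ← Real.norm_eq_abs]
    have hgint : Integrable (fun p : SpaceTime d => θ p.1 * g p.2) := hθi.mul_prod hgi
    refine norm_integral_le_of_norm_le hgint.integrableOn ?_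
    filter_upwards [huR] with p hp
    rw [norm_mul]
    have h1 : ‖pm σ (b (u p) - b k)‖ ≤ 2 * B := by
      rw [Real.norm_of_nonneg (pm_nonneg _ _), pm]
      refine max_le ((le_abs_self _).trans ?_) (by positivity)
      rw [abs_mul, hσ1, one_mul]
      have h3 := hbB _ hp.le
      have h4 := hbB _ hkR
      rw [abs_le] at h3 h4 ⊢
      constructor <;> linarith
    by_cases hx : p.2 ∈ Metric.ball x₀ (1 + δ)
    · have h2 : ‖levyLT μ 1 (fun y => φ (p.1, y)) p.2‖ ≤ θ p.1 * L * m := by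
        rw [Real.norm_eq_abs]
        have hcs : HasCompactSupport fun y => φ (p.1, y) :=
          HasCompactSupport.mul_left (f := fun _ => θ p.1) hψc
        have hcc : Continuous fun y => φ (p.1, y) :=
          (continuous_const (y := θ p.1)).mul hψ.continuous
        refine abs_levyLT_le hμ hcc hcs (mul_nonneg (hθ0 _) hL) fun z => ?_
        simp only [hφ]
        rw [show θ p.1 * ψ (p.2 + z) + θ p.1 * ψ (p.2 - z) - 2 * (θ p.1 * ψ p.2) =
          θ p.1 * (ψ (p.2 + z) + ψ (p.2 - z) - 2 * ψ p.2) by ring, abs_mul, abs_of_nonneg (hθ0 _),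
          mul_assoc]
        exact mul_le_mul_of_nonneg_left (hψL _ _) (hθ0 _)
      rw [hg, indicator_of_mem hx]
      refine (mul_le_mul h1 h2 (norm_nonneg _) (by positivity)).trans (le_of_eq ?_)
      rw [hc]
      ring
    · rw [hg, indicator_of_notMem hx, levyLT_eq_zero]
      · simp
      intro z hz
      have h3 : 1 + δ ≤ ‖p.2 - x₀‖ := by simpa [dist_eq_norm] using hx
      simp only [hφ]
      rw [hψδ p.2 (by linarith), hψδ (p.2 + z)]
      have h4 : ‖p.2 - x₀‖ ≤ ‖p.2 + z - x₀‖ + ‖z‖ := by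
        have := norm_sub_le (p.2 + z - x₀) z
        rwa [show p.2 + z - x₀ - z = p.2 - x₀ by abel] at this
      linarith
  rw [hI1, hJ1, hJ2] at key
  have e1 := (abs_le.1 hI1').2
  have e2 := (abs_le.1 hI2).2
  have e3 := (abs_le.1 hI3).2
  linarith [key, e1, e2, e3]

end WeakEstimate

/-! ### Spatial averages are Lipschitz in time -/

/-- Second differences of a test function are quadratically small. -/
lemma exists_second_difference_le {ρ : Space d → ℝ} (hρ : ContDiff ℝ ∞ ρ)
    (hc : HasCompactSupport ρ) :
    ∃ L : ℝ, 0 ≤ L ∧ ∀ x z, |ρ (x + z) + ρ (x - z) - 2 * ρ x| ≤ L * ‖z‖ ^ 2 := by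
  obtain ⟨K, hK⟩ := ContDiff.lipschitzWith_of_hasCompactSupport (hc.fderiv ℝ)
    (hρ.fderiv_right (m := ∞) (by simp)) (by simp)
  refine ⟨2 * K, by positivity, fun x z => ?_⟩
  have hd : Differentiable ℝ ρ := hρ.differentiable (by simp)
  -- The derivative of `g` is `(Dρ(x+sz) - Dρ(x-sz)) z`, of size at most `2K‖z‖²` on `[0,1]`, where
  -- `K` is a Lipschitz constant of `Dρ`.
  set g : ℝ → ℝ := fun s => ρ (x + s • z) + ρ (x - s • z) with hg
  have hgd : ∀ s, HasDerivAt g (fderiv ℝ ρ (x + s • z) z + fderiv ℝ ρ (x - s • z) (-z)) s := by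
    intro s
    have hz : HasDerivAt (fun s : ℝ => s • z) z s := by
      simpa using (hasDerivAt_id s).smul_const z
    have h1 : HasDerivAt (fun s : ℝ => x + s • z) z s := hz.const_add x
    have h2 : HasDerivAt (fun s : ℝ => x - s • z) (-z) s := hz.const_sub x
    exact ((hd _).hasFDerivAt.comp_hasDerivAt s h1).add ((hd _).hasFDerivAt.comp_hasDerivAt s h2)
  have hb : ∀ s ∈ Ico (0 : ℝ) 1,
      ‖fderiv ℝ ρ (x + s • z) z + fderiv ℝ ρ (x - s • z) (-z)‖ ≤ 2 * K * ‖z‖ ^ 2 := by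
    intro s hs
    have h1 : fderiv ℝ ρ (x + s • z) z + fderiv ℝ ρ (x - s • z) (-z) =
        (fderiv ℝ ρ (x + s • z) - fderiv ℝ ρ (x - s • z)) z := by
      simp [sub_eq_add_neg]
    rw [h1]
    have h2 : ‖fderiv ℝ ρ (x + s • z) - fderiv ℝ ρ (x - s • z)‖ ≤ K * ‖(2 * s) • z‖ := by
      have := hK.dist_le_mul (x + s • z) (x - s • z)
      rw [dist_eq_norm, dist_eq_norm] at this
      rwa [show x + s • z - (x - s • z) = (2 * s) • z by module] at this
    have h3 : ‖(2 * s) • z‖ ≤ 2 * ‖z‖ := by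
      rw [norm_smul, Real.norm_of_nonneg (by linarith [hs.1])]
      exact mul_le_mul_of_nonneg_right (by linarith [hs.2]) (norm_nonneg _)
    calc _ ≤ ‖fderiv ℝ ρ (x + s • z) - fderiv ℝ ρ (x - s • z)‖ * ‖z‖ :=
          ContinuousLinearMap.le_opNorm _ _
      _ ≤ (K * (2 * ‖z‖)) * ‖z‖ := by gcongr; exact h2.trans (by gcongr)
      _ = _ := by ring
  have := norm_image_sub_le_of_norm_deriv_le_segment_01' (fun s _ => (hgd s).hasDerivWithinAt) hb
  simp only [hg, one_smul, zero_smul, add_zero, sub_zero, Real.norm_eq_abs] at this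
  rwa [show ρ (x + z) + ρ (x - z) - (ρ x + ρ x) = ρ (x + z) + ρ (x - z) - 2 * ρ x by ring] at this

open scoped Convolution in
/-- A function of one variable whose distributional derivative on `(0,T)` is bounded by `K`
has difference quotients bounded by `K` almost everywhere. -/
lemma ae_abs_sub_le_of_weak_bound {T K : ℝ} {v : ℝ → ℝ} (hv : LocallyIntegrable v)
    (h : ∀ θ : ℝ → ℝ, ContDiff ℝ ∞ θ → HasCompactSupport θ → tsupport θ ⊆ Ioo 0 T →
      (∀ t, 0 ≤ θ t) → |∫ t, v t * deriv θ t| ≤ K * ∫ t, θ t) :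
    ∀ τ : ℝ, ∀ᵐ t : ℝ, t ∈ Ioo 0 T → t + τ ∈ Ioo 0 T → |v (t + τ) - v t| ≤ K * |τ| := by
  intro τ
  let φ : ℕ → ContDiffBump (0 : ℝ) := fun n =>
    ⟨1 / ((n : ℝ) + 1), 2 * (1 / ((n : ℝ) + 1)), by positivity, by
      have : (0 : ℝ) < 1 / ((n : ℝ) + 1) := by positivity
      linarith⟩
  have hφ0 : Tendsto (fun n => (φ n).rOut) atTop (𝓝 0) := by
    simpa [φ] using (tendsto_one_div_add_atTop_nhds_zero_nat (𝕜 := ℝ)).const_mul 2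
  -- The outer radius is twice the inner one; a bounded ratio gives convergence of the
  -- mollifications almost everywhere, by Lebesgue differentiation.
  have hconv := ContDiffBump.ae_convolution_tendsto_right_of_locallyIntegrable (μ := volume)
    (K := 2) hφ0 (Eventually.of_forall fun n => le_rfl) hv
  set w : ℕ → ℝ → ℝ := fun n =>
    ((φ n).normed volume ⋆[ContinuousLinearMap.lsmul ℝ ℝ, volume] v) with hw
  have hwd : ∀ n t, HasDerivAt (w n)
      ((deriv ((φ n).normed volume) ⋆[ContinuousLinearMap.lsmul ℝ ℝ, volume] v) t) t := fun n t =>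
    (φ n).hasCompactSupport_normed.hasDerivAt_convolution_left _
      ((φ n).contDiff_normed (n := 1)) hv t
  have hbd : ∀ n t, t ∈ Ioo (φ n).rOut (T - (φ n).rOut) →
      ‖(deriv ((φ n).normed volume) ⋆[ContinuousLinearMap.lsmul ℝ ℝ, volume] v) t‖ ≤ K := by
    intro n t ht
    have hs : ContDiff ℝ ∞ ((φ n).normed volume) := (φ n).contDiff_normed (n := ⊤)
    -- The reflected kernel is an admissible test function of mass one when `t` is farther than its
    -- radius from `0` and `T`. The derivative of the mollified `v` at `t` is minus the pairing of
    -- `v` with `θ'`, so it is at most `K` in size.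
    set θ : ℝ → ℝ := fun s => (φ n).normed volume (t - s) with hθ
    have hsupp : tsupport θ ⊆ Metric.closedBall t (φ n).rOut := by
      refine closure_minimal (fun s hsθ => ?_) Metric.isClosed_closedBall
      have h1 : t - s ∈ Function.support ((φ n).normed volume) := hsθ
      rw [(φ n).support_normed_eq] at h1
      rw [Metric.mem_closedBall, dist_comm, Real.dist_eq]
      simpa using (le_of_lt (by simpa using h1) : |t - s| ≤ (φ n).rOut)
    have h1 := h θ (hs.comp (contDiff_const.sub contDiff_id))
      ((isCompact_closedBall t _).of_isClosed_subset (isClosed_tsupport _) hsupp)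
      (fun s hs => by
        have h2 := hsupp hs
        rw [Metric.mem_closedBall, Real.dist_eq, abs_le] at h2
        exact ⟨by linarith [ht.1], by linarith [ht.2]⟩)
      (fun s => (φ n).nonneg_normed _)
    have h2 : ∫ s, θ s = 1 := by
      rw [hθ, integral_sub_left_eq_self (fun s => (φ n).normed volume s)]
      exact (φ n).integral_normed
    have h3 : ∀ s, deriv θ s = -deriv ((φ n).normed volume) (t - s) := fun s =>
      deriv_comp_const_sub _ _ _
    rw [h2, mul_one] at h1
    rw [convolution_eq_swap]
    simp only [h3, mul_neg, integral_neg, abs_neg] at h1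
    simpa [mul_comm] using h1
  have hlip : ∀ n s t, s ∈ Ioo (φ n).rOut (T - (φ n).rOut) → t ∈ Ioo (φ n).rOut (T - (φ n).rOut) →
      |w n t - w n s| ≤ K * |t - s| := fun n s t hs ht =>
    (convex_Ioo _ _).norm_image_sub_le_of_norm_hasDerivWithin_le
      (fun x _ => (hwd n x).hasDerivWithinAt) (fun x hx => hbd n x hx) hs ht
  filter_upwards [hconv,
    (measurePreserving_add_right volume τ).quasiMeasurePreserving.ae hconv] with s hs ht hsT htT
  refine le_of_tendsto ((ht.sub hs).abs) ?_
  have hev : ∀ x ∈ Ioo 0 T, ∀ᶠ n in atTop, x ∈ Ioo (φ n).rOut (T - (φ n).rOut) := by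
    intro x hx
    filter_upwards [hφ0.eventually_lt_const hx.1, hφ0.eventually_lt_const (sub_pos.2 hx.2)]
      with n h1 h2
    exact ⟨h1, by linarith⟩
  filter_upwards [hev _ htT, hev s hsT] with n h1 h2
  simpa using hlip n s (s + τ) h2 h1

section

variable {T : ℝ} {Ω : Set (Space d)} {f : ℝ → Space d} {Lf : ℝ → ℝ≥0} {b : ℝ → ℝ}
  {uc ubar : SpaceTime d → ℝ} {u₀ : Space d → ℝ}

/-- Spatial averages of solutions are Lipschitz in time, uniformly with respect to the solution,
the Lévy measure and the center of the average. -/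
theorem exists_time_lipschitz_average (hT : 0 < T) (hΩo : IsOpen Ω) (hΩb : Bornology.IsBounded Ω)
    (hf : Continuous f) {R F B M : ℝ} (hR : 0 < R) (hB : 0 ≤ B)
    (hF : ∀ v w, |v| ≤ R → |w| ≤ R → ‖f v - f w‖ ≤ F) (hbB : ∀ v, |v| ≤ R → |b v| ≤ B)
    {ρ : Space d → ℝ} (hρ : ContDiff ℝ ∞ ρ) (hρc : HasCompactSupport ρ) (hρ0 : ∀ x, 0 ≤ ρ x) :
    ∃ K : ℝ, 0 ≤ K ∧ ∀ (μ : Measure (Space d)) (u U : SpaceTime d → ℝ), IsSymmLevy μ →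
      levyMass μ ≤ M → IsEntropySolution T Ω f Lf b uc ubar u₀ μ u →
      (∀ᵐ p ∂(volume.restrict (slab d T)), |u p| < R) → Measurable U → (∀ p, |U p| ≤ R) →
      (∀ᵐ p ∂(volume.restrict (cyl T Ω)), U p = u p) → (∀ p ∉ cyl T Ω, U p = 0) →
      ∀ x₀, (∀ y ∉ Ω, ρ (y - x₀) = 0) → ∀ τ : ℝ, ∀ᵐ t : ℝ, t ∈ Ioo 0 T → t + τ ∈ Ioo 0 T →
        |(∫ y, U (t + τ, y) * ρ (y - x₀)) - ∫ y, U (t, y) * ρ (y - x₀)| ≤ K * |τ| := by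
  obtain ⟨P, hP⟩ := hρ.continuous.bounded_above_of_compact_support hρc
  obtain ⟨G, hG⟩ := (hρ.continuous_fderiv (by simp)).bounded_above_of_compact_support (hρc.fderiv ℝ)
  obtain ⟨L, hL, hL2⟩ := exists_second_difference_le hρ hρc
  obtain ⟨δ, hδ0, hδ⟩ := hρc.exists_pos_le_norm
  have hF0 : 0 ≤ F := (norm_nonneg _).trans (hF 0 0 (by simpa using hR.le) (by simpa using hR.le))
  have hG0 : 0 ≤ G := (norm_nonneg _).trans (hG 0)
  have hP0 : 0 ≤ P := (norm_nonneg _).trans (hP 0)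
  set W := volume.real (Metric.ball (0 : Space d) (1 + δ)) with hW
  -- The constant from `IsEntropySolution.neg_mul_integral_le`, with the mass replaced by `|M|`. It
  -- does not see `x₀`, since the bounds on `ρ` and the volume `W` are translation invariant.
  refine ⟨(F * G + 2 * B * |M| * P) * volume.real Ω + 2 * B * (L * |M|) * W, by positivity, ?_⟩
  intro μ u U hμ hμM hu huR hUm hUR hUu hU0 x₀ hx₀
  have hm0 := levyMass_nonneg μ
  set ψ : Space d → ℝ := fun y => ρ (y - x₀) with hψ
  have hψs : ContDiff ℝ ∞ ψ := hρ.comp (contDiff_id.sub contDiff_const)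
  have hψc : HasCompactSupport ψ := hρc.comp_homeomorph (Homeomorph.subRight x₀)
  have hprod : Integrable (fun p : SpaceTime d => U p * ψ p.2) := by
    have h1 : IntegrableOn (fun p : SpaceTime d => U p * ψ p.2) (cyl T Ω) := by
      refine IntegrableOn.of_bound (volume_cyl_lt_top T hΩb)
        (hUm.mul (hψs.continuous.measurable.comp measurable_snd)).aestronglyMeasurable (R * P)
        (Eventually.of_forall fun p => ?_)
      rw [norm_mul]
      exact mul_le_mul (hUR p) (hP _) (norm_nonneg _) hR.le
    refine (integrableOn_iff_integrable_of_support_subset fun p hp => ?_).1 h1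
    by_contra hcon
    exact hp (by simp [hU0 p hcon])
  refine ae_abs_sub_le_of_weak_bound
    (v := fun t => ∫ y, U (t, y) * ψ y) hprod.integral_prod_left.locallyIntegrable ?_
  intro θ hθ hθc hθT hθ0
  have hθ1 : ∫ t, θ t = ∫ t in Ioo 0 T, θ t := by
    rw [setIntegral_eq_integral_of_forall_compl_eq_zero]
    exact fun t ht => image_eq_zero_of_notMem_tsupport fun h => ht (hθT h)
  obtain ⟨Cθ, hCθ⟩ := (hθ.continuous_deriv (by simp)).bounded_above_of_compact_support hθc.deriv
  have hprod2 : Integrable (fun p : SpaceTime d => U p * (deriv θ p.1 * ψ p.2)) := by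
    have h1 : Integrable (fun p : SpaceTime d => deriv θ p.1 * (U p * ψ p.2)) :=
      hprod.bdd_mul (c := Cθ)
        ((hθ.continuous_deriv (by simp)).comp continuous_fst).aestronglyMeasurable
        (Eventually.of_forall fun p => hCθ _)
    refine h1.congr (Eventually.of_forall fun p => ?_)
    simp only; ring
  have hint : ∫ t, (∫ y, U (t, y) * ψ y) * deriv θ t =
      ∫ p in cyl T Ω, u p * (deriv θ p.1 * ψ p.2) := by
    have h1 : ∫ p in cyl T Ω, u p * (deriv θ p.1 * ψ p.2) =
        ∫ p in cyl T Ω, U p * (deriv θ p.1 * ψ p.2) := by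
      refine integral_congr_ae ?_
      filter_upwards [hUu] with p hp
      rw [hp]
    rw [h1, setIntegral_eq_integral_of_forall_compl_eq_zero fun p hp => by rw [hU0 p hp, zero_mul],
      Measure.volume_eq_prod, integral_prod _ hprod2]
    refine integral_congr_ae (Eventually.of_forall fun t => ?_)
    simp only
    rw [← integral_mul_const]
    congr 1
    funext y
    ring
  have hbound : ((F * G + 2 * B * levyMass μ * P) * volume.real Ω +
        2 * B * (L * levyMass μ) * volume.real (Metric.ball x₀ (1 + δ))) * ∫ t in Ioo 0 T, θ t ≤
      ((F * G + 2 * B * |M| * P) * volume.real Ω + 2 * B * (L * |M|) * W) * ∫ t, θ t := by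
    rw [hθ1, Measure.addHaar_real_ball_center, ← hW]
    have h1 : levyMass μ ≤ |M| := hμM.trans (le_abs_self M)
    have h2 : 0 ≤ ∫ t in Ioo 0 T, θ t := integral_nonneg hθ0
    gcongr
  have main : ∀ σ : ℝ, (σ = 1 ∨ σ = -1) → _ := fun σ hσ =>
    (hu.neg_mul_integral_le hT hΩo hΩb hf hμ hR hB huR hF hbB hψs hψc (fun x => hρ0 _) hx₀ hL
      (P := P) (G := G) (δ := δ) (L := L) (x₀ := x₀)
      (fun x => (le_abs_self _).trans (hP _))
      (fun x => by
        rw [hψ, fderiv_comp_sub]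
        exact hG _)
      (fun x z => by
        have := hL2 (x - x₀) z
        simp only [hψ]
        rwa [show x + z - x₀ = x - x₀ + z by abel, show x - z - x₀ = x - x₀ - z by abel])
      (fun x hx => hδ _ hx) hθ hθc hθT hθ0 hσ).trans hbound
  rw [hint, abs_le]
  have m1 := main 1 (Or.inl rfl)
  have m2 := main (-1) (Or.inr rfl)
  constructor <;> linarith

end

/-! ### Pairing increments of `γ` with spatial averages -/

lemma integrable_of_abs_le_of_support {α : Type*} [MeasurableSpace α] {ν : Measure α} {g : α → ℝ}
    (hg : Measurable g) {C : ℝ} (hC : ∀ p, |g p| ≤ C) {s : Set α} (hs : ν s < ⊤)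
    (h0 : ∀ p ∉ s, g p = 0) : Integrable g ν := by
  refine (integrableOn_iff_integrable_of_support_subset fun p hp => ?_).1
    (IntegrableOn.of_bound hs hg.aestronglyMeasurable C (Eventually.of_forall hC))
  by_contra hcon
  exact hp (h0 p hcon)

/-- A pairing `∫ G V` is small if it varies little under translation of `V` in space and the
spatial averages of `V` are small on the support of `G`. -/
lemma abs_integral_mul_le_of_average {G V : SpaceTime d → ℝ} {ρ : Space d → ℝ} {C δ a c : ℝ}
    (hG : Integrable G) (hV : Measurable V) (hVC : ∀ p, |V p| ≤ C) (hρ : Integrable ρ)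
    (hρ0 : ∀ x, 0 ≤ ρ x) (hρ1 : ∫ x, ρ x = 1) (hρδ : ∀ x, δ ≤ ‖x‖ → ρ x = 0)
    (ha : ∀ h : Space d, ‖h‖ < δ → |(∫ p, G p * V p) - ∫ p, G p * V (p + (0, h))| ≤ a)
    (hc : ∀ᵐ p, G p ≠ 0 → |∫ h, ρ h * V (p + (0, h))| ≤ c) :
    |∫ p, G p * V p| ≤ a + c * ∫ p, |G p| := by
  have hprod : Integrable (fun q : Space d × SpaceTime d => ρ q.1 * (G q.2 * V (q.2 + (0, q.1))))
      ((volume : Measure (Space d)).prod (volume : Measure (SpaceTime d))) := by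
    have h1 : Integrable (fun q : Space d × SpaceTime d => V (q.2 + (0, q.1)) * (ρ q.1 * G q.2))
        ((volume : Measure (Space d)).prod (volume : Measure (SpaceTime d))) := by
      refine (hρ.mul_prod hG).bdd_mul (c := C) ?_ (Eventually.of_forall fun q => hVC _)
      exact (hV.comp (measurable_snd.add
        (measurable_const.prodMk measurable_fst))).aestronglyMeasurable
    refine h1.congr (Eventually.of_forall fun q => ?_)
    simp only; ring
  set F : Space d → ℝ := fun h => ∫ p, G p * V (p + (0, h)) with hF
  have hFi : Integrable fun h => ρ h * F h := by
    have := hprod.integral_prod_left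
    refine this.congr (Eventually.of_forall fun h => ?_)
    simp only [hF]
    rw [← integral_const_mul]
  have hswap : ∫ h, ρ h * F h = ∫ p, G p * ∫ h, ρ h * V (p + (0, h)) := by
    have h1 := integral_integral_swap (f := fun (h : Space d) (p : SpaceTime d) =>
      ρ h * (G p * V (p + (0, h)))) hprod
    simp only [hF]
    simp_rw [← integral_const_mul]
    rw [h1]
    congr 1; funext p; congr 1; funext h; ring
  have h1 : |∫ h, ρ h * F h| ≤ c * ∫ p, |G p| := by
    rw [hswap, ← integral_const_mul, ← Real.norm_eq_abs]
    refine norm_integral_le_of_norm_le (hG.abs.const_mul c) ?_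
    filter_upwards [hc] with p hp
    rw [norm_mul, Real.norm_eq_abs, Real.norm_eq_abs, mul_comm]
    rcases eq_or_ne (G p) 0 with h | h
    · simp [h]
    · exact mul_le_mul_of_nonneg_right (hp h) (abs_nonneg _)
  have h2 : |∫ h, ρ h * ((∫ p, G p * V p) - F h)| ≤ a := by
    have h3 : ∫ h, ρ h * a = a := by rw [integral_mul_const, hρ1, one_mul]
    rw [← Real.norm_eq_abs]
    conv_rhs => rw [← h3]
    refine norm_integral_le_of_norm_le (hρ.mul_const a) (Eventually.of_forall fun h => ?_)
    rw [norm_mul, Real.norm_of_nonneg (hρ0 h)]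
    rcases lt_or_ge ‖h‖ δ with hlt | hge
    · exact mul_le_mul_of_nonneg_left (ha h hlt) (hρ0 h)
    · simp [hρδ h hge]
  -- As `ρ` has mass one, the pairing splits into the cost of translating, bounded by `a`, and the
  -- pairing of `G` with the averaged `V`.
  have h3 : ∫ p, G p * V p = (∫ h, ρ h * ((∫ p, G p * V p) - F h)) + ∫ h, ρ h * F h := by
    rw [← integral_add _ hFi]
    · have : ∀ h, ρ h * ((∫ p, G p * V p) - F h) + ρ h * F h = ρ h * ∫ p, G p * V p :=
        fun h => by ring
      simp_rw [this]
      rw [integral_mul_const, hρ1, one_mul]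
    · have : Integrable fun h => ρ h * (∫ p, G p * V p) - ρ h * F h := (hρ.mul_const _).sub hFi
      refine this.congr (Eventually.of_forall fun h => ?_)
      simp only; ring
  rw [h3]
  exact (abs_add_le _ _).trans (add_le_add h2 h1)

/-- The points of `Ω` at distance more than `δ` from its complement. -/
def innerPart (δ : ℝ) (Ω : Set (Space d)) : Set (Space d) := (Metric.cthickening δ Ωᶜ)ᶜ

lemma measurableSet_innerPart (δ : ℝ) (Ω : Set (Space d)) : MeasurableSet (innerPart δ Ω) :=
  Metric.isClosed_cthickening.measurableSet.compl

lemma innerPart_subset (δ : ℝ) (Ω : Set (Space d)) : innerPart δ Ω ⊆ Ω := by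
  rw [innerPart, compl_subset_comm]
  exact Metric.self_subset_cthickening _

lemma mem_of_mem_innerPart {δ : ℝ} {Ω : Set (Space d)} {x y : Space d} (hx : x ∈ innerPart δ Ω)
    (h : ‖y - x‖ ≤ δ) : y ∈ Ω := by
  by_contra hy
  exact hx (Metric.mem_cthickening_of_dist_le x y δ Ωᶜ hy (by rwa [dist_comm, dist_eq_norm]))

/-- The closed thickenings of the closed set `Ωᶜ` shrink to `Ωᶜ`, which is null for Lebesgue measure
restricted to `Ω`; that measure is finite, so continuity from above applies. -/
lemma tendsto_volume_diff_innerPart {Ω : Set (Space d)} (hΩo : IsOpen Ω)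
    (hΩb : Bornology.IsBounded Ω) :
    Tendsto (fun δ => volume.real (Ω \ innerPart δ Ω)) (𝓝 0) (𝓝 0) := by
  have : IsFiniteMeasure (volume.restrict Ω) := isFiniteMeasure_restrict.2 hΩb.measure_lt_top.ne
  have h1 := tendsto_measure_cthickening_of_isClosed (μ := volume.restrict Ω) (s := Ωᶜ)
    ⟨1, one_pos, measure_ne_top _ _⟩ hΩo.isClosed_compl
  have h2 : ∀ δ, (volume.restrict Ω) (Metric.cthickening δ Ωᶜ) = volume (Ω \ innerPart δ Ω) := by
    intro δ
    rw [Measure.restrict_apply Metric.isClosed_cthickening.measurableSet, innerPart, sdiff_compl,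
      inter_comm]
  have h3 : (volume.restrict Ω) Ωᶜ = 0 := by
    rw [Measure.restrict_apply hΩo.measurableSet.compl]; simp
  simp_rw [h2] at h1
  rw [h3] at h1
  exact (ENNReal.tendsto_toReal ENNReal.zero_ne_top).comp h1

/-- The exceptional times in `hK` depend on the centre `x₀`. The set of bad pairs (time, centre) is
measurable with null time slices, so Fubini makes it null in space-time. -/
lemma ae_abs_average_le {T K δ τ R : ℝ} {Ω : Set (Space d)} {U : SpaceTime d → ℝ}
    (hUm : Measurable U) (hUR : ∀ p, |U p| ≤ R) {ρ : Space d → ℝ} (hρc : Continuous ρ)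
    (hρ : Integrable ρ) (hρδ : ∀ x, δ ≤ ‖x‖ → ρ x = 0)
    (hK : ∀ x₀, (∀ y ∉ Ω, ρ (y - x₀) = 0) → ∀ᵐ t : ℝ, t ∈ Ioo 0 T → t + τ ∈ Ioo 0 T →
        |(∫ y, U (t + τ, y) * ρ (y - x₀)) - ∫ y, U (t, y) * ρ (y - x₀)| ≤ K * |τ|) :
    ∀ᵐ p : SpaceTime d, p.1 ∈ Ioo 0 T → p.1 + τ ∈ Ioo 0 T → p.2 ∈ innerPart δ Ω →
      |∫ h, ρ h * (U (p + (0, h) + (τ, 0)) - U (p + (0, h)))| ≤ K * |τ| := by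
  have hslice : ∀ t x₀, Integrable fun y => U (t, y) * ρ (y - x₀) := fun t x₀ =>
    (hρ.comp_sub_right x₀).bdd_mul (c := R)
      (hUm.comp measurable_prodMk_left).aestronglyMeasurable (Eventually.of_forall fun y => hUR _)
  set A : SpaceTime d → ℝ := fun p =>
    (∫ y, U (p.1 + τ, y) * ρ (y - p.2)) - ∫ y, U (p.1, y) * ρ (y - p.2) with hA
  have hAm : Measurable A := by
    refine Measurable.sub ?_ ?_
    · refine (StronglyMeasurable.integral_prod_right (f := fun (p : SpaceTime d) (y : Space d) =>
        U (p.1 + τ, y) * ρ (y - p.2)) ?_).measurable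
      refine Measurable.stronglyMeasurable ?_
      exact (hUm.comp (by fun_prop)).mul (hρc.measurable.comp (by fun_prop))
    · refine (StronglyMeasurable.integral_prod_right (f := fun (p : SpaceTime d) (y : Space d) =>
        U (p.1, y) * ρ (y - p.2)) ?_).measurable
      refine Measurable.stronglyMeasurable ?_
      exact (hUm.comp (by fun_prop)).mul (hρc.measurable.comp (by fun_prop))
  have heq : ∀ p : SpaceTime d, ∫ h, ρ h * (U (p + (0, h) + (τ, 0)) - U (p + (0, h))) = A p := by
    intro p
    simp only [hA]
    rw [← integral_sub (hslice _ _) (hslice _ _),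
      ← integral_add_left_eq_self (fun y => U (p.1 + τ, y) * ρ (y - p.2) - U (p.1, y) * ρ (y - p.2))
        p.2]
    congr 1
    funext h
    have h1 : p + (0, h) + (τ, 0) = (p.1 + τ, p.2 + h) := by ext <;> simp
    have h2 : p + (0, h) = (p.1, p.2 + h) := by ext <;> simp
    rw [h1, h2, add_sub_cancel_left]
    ring
  set N : Set (SpaceTime d) := {p | (p.1 ∈ Ioo 0 T ∧ p.1 + τ ∈ Ioo 0 T) ∧ p.2 ∈ innerPart δ Ω ∧
    K * |τ| < |A p|} with hN
  have hNm : MeasurableSet N := by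
    refine MeasurableSet.inter (MeasurableSet.inter ?_ ?_) (MeasurableSet.inter ?_ ?_)
    · exact measurable_fst measurableSet_Ioo
    · exact (measurable_fst.add_const τ) measurableSet_Ioo
    · exact measurable_snd (measurableSet_innerPart δ Ω)
    · exact measurableSet_lt measurable_const (continuous_abs.measurable.comp hAm)
  have hN0 : volume N = 0 := by
    rw [Measure.volume_eq_prod, Measure.prod_apply_symm hNm]
    refine (lintegral_congr fun x => ?_).trans lintegral_zero
    by_cases hx : x ∈ innerPart δ Ω
    · have h1 := hK x fun y hy => hρδ _ (by
        by_contra hcon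
        exact hy (mem_of_mem_innerPart hx (not_le.1 hcon).le))
      refine measure_mono_null (fun t ht => ?_) (ae_iff.1 h1)
      intro hcon
      exact (hcon ht.1.1 ht.1.2).not_gt ht.2.2
    · convert measure_empty (μ := (volume : Measure ℝ))
      ext t
      simp only [hN, mem_preimage, mem_ofPred_eq, mem_empty_iff_false, iff_false]
      exact fun h => hx h.2.1
  filter_upwards [measure_eq_zero_iff_ae_notMem.1 hN0] with p hp h1 h2 h3
  rw [heq]
  by_contra hcon
  exact hp ⟨⟨h1, h2⟩, h3, not_le.1 hcon⟩

lemma integral_indicator_const' {α : Type*} [MeasurableSpace α] {ν : Measure α} {s : Set α}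
    (hs : MeasurableSet s) (c : ℝ) : ∫ p, s.indicator (fun _ => c) p ∂ν = c * ν.real s := by
  rw [integral_indicator_const c hs, smul_eq_mul, mul_comm]

lemma integrable_indicator_const {α : Type*} [MeasurableSpace α] {ν : Measure α} {s : Set α}
    (hs : MeasurableSet s) (h : ν s < ⊤) (c : ℝ) : Integrable (s.indicator fun _ => c) ν :=
  (integrable_indicator_iff hs).2 (integrableOn_const h.ne)

lemma volume_real_prod_le {I : Set ℝ} {S : Set (Space d)} {c : ℝ} (hI : volume.real I ≤ c) :
    volume.real (I ×ˢ S : Set (SpaceTime d)) ≤ c * volume.real S := by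
  rw [Measure.volume_eq_prod, measureReal_prod_prod]
  exact mul_le_mul_of_nonneg_right hI measureReal_nonneg

/-- The pairing of time increments of `γ` and `U` varies little under translations in space. -/
lemma abs_pairing_sub_translate_le {T τ R B ε : ℝ} {Ω : Set (Space d)}
    (hΩo : IsOpen Ω) (hΩb : Bornology.IsBounded Ω) (hτ0 : 0 < τ) (hτT : τ < T) (hR : 0 ≤ R)
    (hε : 0 < ε) {S : Set (Space d)} (hS : MeasurableSet S) (hSΩ : S ⊆ Ω)
    {U γ : SpaceTime d → ℝ} (hUm : Measurable U) (hγm : Measurable γ) (hUR : ∀ p, |U p| ≤ R)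
    (hγB : ∀ p, |γ p| ≤ B) (hU0 : ∀ p ∉ cyl T Ω, U p = 0) (hγ0 : ∀ p ∉ cyl T Ω, γ p = 0)
    {G V : SpaceTime d → ℝ} (hV : ∀ p, V p = U (p + (τ, 0)) - U p)
    (hG : G = (Ioo 0 (T - τ) ×ˢ S).indicator fun p => γ (p + (τ, 0)) - γ p)
    {h : Space d} (hsp : ∫ p, (γ (p + (0, -h)) - γ p) ^ 2 ≤ ε ^ 2) :
    |(∫ p, G p * V p) - ∫ p, G p * V (p + (0, h))| ≤
      2 * R * (ε * (T * volume.real Ω / 2 + 2) + 4 * B * T * volume.real (Ω \ S)) := by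
  have hB : 0 ≤ B := (abs_nonneg _).trans (hγB 0)
  set I : Set ℝ := Ioo 0 (T - τ) with hI
  have hIm : volume.real I ≤ T := by
    rw [hI, Real.volume_real_Ioo_of_le (by linarith)]; linarith
  set D : SpaceTime d → ℝ := fun p => γ (p + (τ, 0)) - γ p with hD
  have hDm : Measurable D := (hγm.comp (measurable_add_const _)).sub hγm
  have hDB : ∀ p, |D p| ≤ 2 * B := fun p => by
    have h1 := abs_le.1 (hγB (p + (τ, 0)))
    have h2 := abs_le.1 (hγB p)
    exact abs_le.2 ⟨by simp only [hD]; linarith, by simp only [hD]; linarith⟩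
  have hVR : ∀ p, |V p| ≤ 2 * R := fun p => by
    have h1 := abs_le.1 (hUR (p + (τ, 0)))
    have h2 := abs_le.1 (hUR p)
    rw [hV]
    exact abs_le.2 ⟨by linarith, by linarith⟩
  have hVm : Measurable V := by
    rw [show V = fun p => U (p + (τ, 0)) - U p from funext hV]
    exact (hUm.comp (measurable_add_const _)).sub hUm
  have hQ := volume_cyl_lt_top T hΩb
  have hγ2 : ∀ q : SpaceTime d, Integrable fun p => (γ (p + q) - γ p) ^ 2 := by
    intro q
    have h1 : Integrable γ := integrable_of_abs_le_of_support hγm hγB hQ hγ0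
    have h2 : Integrable fun p => γ (p + q) - γ p := (h1.comp_add_right q).sub h1
    have h3 : Integrable fun p => (γ (p + q) - γ p) * (γ (p + q) - γ p) := by
      refine h2.bdd_mul (c := 2 * B) ((hγm.comp (measurable_add_const _)).sub
        hγm).aestronglyMeasurable (Eventually.of_forall fun p => ?_)
      have h1 := abs_le.1 (hγB (p + q))
      have h2 := abs_le.1 (hγB p)
      exact abs_le.2 ⟨by linarith, by linarith⟩
    simpa only [sq] using h3
  have hIS : MeasurableSet (I ×ˢ S : Set (SpaceTime d)) := measurableSet_Ioo.prod hS
  have hIΩ : MeasurableSet (I ×ˢ Ω : Set (SpaceTime d)) := measurableSet_Ioo.prod hΩo.measurableSet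
  have hIP : MeasurableSet (I ×ˢ (Ω \ S) : Set (SpaceTime d)) :=
    measurableSet_Ioo.prod (hΩo.measurableSet.diff hS)
  have hsub : (I ×ˢ Ω : Set (SpaceTime d)) ⊆ cyl T Ω :=
    prod_mono_left (Ioo_subset_Ioo_right (by linarith))
  have hIΩf : volume (I ×ˢ Ω : Set (SpaceTime d)) < ⊤ := (measure_mono hsub).trans_lt hQ
  have hIPf : volume (I ×ˢ (Ω \ S) : Set (SpaceTime d)) < ⊤ :=
    (measure_mono (prod_mono_right sdiff_subset)).trans_lt hIΩf
  have hISf : volume (I ×ˢ S : Set (SpaceTime d)) < ⊤ :=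
    (measure_mono (prod_mono_right hSΩ)).trans_lt hIΩf
  have hGm : Measurable G := by rw [hG]; exact hDm.indicator hIS
  have hGi : Integrable G := by
    refine integrable_of_abs_le_of_support (C := 2 * B) hGm (fun p => ?_) hISf fun p hp => ?_
    · by_cases hp : p ∈ (I ×ˢ S : Set (SpaceTime d))
      · rw [hG, indicator_of_mem hp]; exact hDB p
      · rw [hG, indicator_of_notMem hp]; simpa using hB
    · rw [hG, indicator_of_notMem hp]
  have hGV : ∀ q : SpaceTime d, Integrable fun p => G (p + q) * V p := fun q =>
    (hGi.comp_add_right q).mul_bdd (c := 2 * R) hVm.aestronglyMeasurable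
      (Eventually.of_forall hVR)
  -- The translation is moved off `V`, about which only boundedness is known, onto `G`, which is
  -- built from `γ`.
  have htr : ∫ p, G p * V (p + (0, h)) = ∫ p, G (p + (0, -h)) * V p := by
    rw [← integral_add_right_eq_self (fun p => G (p + (0, -h)) * V p) ((0, h) : SpaceTime d)]
    congr 1
    funext p
    have : p + (0, h) + (0, -h) = p := by ext <;> simp
    rw [this]
  have hGV0 : Integrable fun p => G p * V p := by simpa using hGV 0
  rw [htr, ← integral_sub hGV0 (hGV _)]
  set E : SpaceTime d → ℝ := (I ×ˢ Ω : Set (SpaceTime d)).indicator fun _ => ε / 2 with hE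
  set P : SpaceTime d → ℝ := (I ×ˢ (Ω \ S) : Set (SpaceTime d)).indicator fun _ => 2 * B with hP
  have hEi : Integrable E := integrable_indicator_const hIΩ hIΩf _
  have hPi : Integrable P := integrable_indicator_const hIP hIPf _
  set g : SpaceTime d → ℝ := fun p => (γ (p + (0, -h)) - γ p) ^ 2 with hg
  have hgi : Integrable g := hγ2 _
  have hP0 : ∀ p, 0 ≤ P p := fun p => indicator_nonneg (fun _ _ => by positivity) p
  have hg0 : ∀ p, 0 ≤ g p := fun p => sq_nonneg _
  have hpt : ∀ p, ‖G p * V p - G (p + (0, -h)) * V p‖ ≤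
      2 * R * (E p + (1 / ε) * (g (p + (τ, 0)) + g p) + (P p + P (p + (0, -h)))) := by
    intro p
    have hRHS : 0 ≤ 2 * R * (E p + (1 / ε) * (g (p + (τ, 0)) + g p) + (P p + P (p + (0, -h)))) := by
      have h1 : 0 ≤ E p := indicator_nonneg (fun _ _ => by positivity) p
      have h2 := hP0 p
      have h3 := hP0 (p + (0, -h))
      have h4 := hg0 p
      have h5 := hg0 (p + (τ, 0))
      positivity
    by_cases hpI : p.1 ∈ I
    swap
    · have h1 : G p = 0 := by rw [hG, indicator_of_notMem]; exact fun h => hpI h.1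
      have h2 : G (p + (0, -h)) = 0 := by
        rw [hG, indicator_of_notMem]; exact fun h => hpI (by simpa using h.1)
      rw [h1, h2]; simpa using hRHS
    by_cases hpΩ : p.2 ∈ Ω
    swap
    · have h1 : V p = 0 := by
        rw [hV, hU0 p (fun h => hpΩ h.2), hU0 _ (fun h => hpΩ (by simpa using h.2)), sub_zero]
      rw [h1]; simpa using hRHS
    -- At times in `I`, cutting `D` off to `S` loses only its values over `Ω \ S`, since `D`
    -- vanishes outside `Ω`.
    have hGD : ∀ q : SpaceTime d, q.1 ∈ I → |G q - D q| ≤ P q := by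
      intro q hq
      by_cases hqS : q.2 ∈ S
      · rw [hG, indicator_of_mem (show q ∈ I ×ˢ S from ⟨hq, hqS⟩)]
        simpa [hD] using hP0 q
      · rw [hG, indicator_of_notMem (fun h => hqS h.2), zero_sub, abs_neg]
        by_cases hqΩ : q.2 ∈ Ω
        · rw [hP, indicator_of_mem (show q ∈ I ×ˢ (Ω \ S) from ⟨hq, hqΩ, hqS⟩)]
          exact hDB q
        · have : D q = 0 := by
            simp only [hD]
            rw [hγ0 q (fun h => hqΩ h.2), hγ0 _ (fun h => hqΩ (by simpa using h.2)), sub_zero]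
          rw [this, abs_zero]; exact hP0 q
    have h1 := hGD p hpI
    have h2 := hGD (p + (0, -h)) (by simpa using hpI)
    have hDD : |D p - D (p + (0, -h))| ≤ ε / 2 + (1 / ε) * (g (p + (τ, 0)) + g p) := by
      have hcomm : p + (0, -h) + (τ, 0) = p + (τ, 0) + (0, -h) := by abel
      set α := γ (p + (τ, 0) + (0, -h)) - γ (p + (τ, 0)) with hα
      set β := γ (p + (0, -h)) - γ p with hβ
      have e1 : D p - D (p + (0, -h)) = β - α := by
        simp only [hD, hα, hβ, hcomm]; ring
      have e2 : g (p + (τ, 0)) = α ^ 2 := rfl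
      have e3 : g p = β ^ 2 := rfl
      rw [e1, e2, e3]
      -- Young's inequality in place of Cauchy–Schwarz: `α` and `β` have squared integral at most
      -- `ε²`, so after division by `ε` everything is linear in `ε`.
      have h4 : ε * |β - α| ≤ ε ^ 2 / 2 + (α ^ 2 + β ^ 2) := by
        nlinarith [sq_nonneg (ε - |β - α|), sq_abs (β - α), sq_nonneg (β + α)]
      have h5 : ε / 2 + 1 / ε * (α ^ 2 + β ^ 2) = (ε ^ 2 / 2 + (α ^ 2 + β ^ 2)) / ε := by
        field_simp
      rw [h5, le_div_iff₀ hε]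
      linarith
    rw [← sub_mul, norm_mul, Real.norm_eq_abs, Real.norm_eq_abs, mul_comm, hE,
      indicator_of_mem (show p ∈ I ×ˢ Ω from ⟨hpI, hpΩ⟩)]
    refine mul_le_mul (hVR p) ?_ (abs_nonneg _) (by positivity)
    rw [abs_le] at h1 h2 hDD ⊢
    constructor <;> linarith
  have hgt : Integrable fun p => g (p + (τ, 0)) := hgi.comp_add_right _
  have hPt : Integrable fun p => P (p + (0, -h)) := hPi.comp_add_right _
  have hi1 : Integrable fun p => (1 / ε) * (g (p + (τ, 0)) + g p) := (hgt.add hgi).const_mul _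
  have hi2 : Integrable fun p => P p + P (p + (0, -h)) := hPi.add hPt
  have hi3 : Integrable fun p => E p + (1 / ε) * (g (p + (τ, 0)) + g p) := hEi.add hi1
  have hi4 : Integrable fun p => 2 * R * (E p + (1 / ε) * (g (p + (τ, 0)) + g p) +
      (P p + P (p + (0, -h)))) := (hi3.add hi2).const_mul _
  refine (norm_integral_le_of_norm_le hi4 (Eventually.of_forall hpt)).trans ?_
  rw [integral_const_mul, integral_add hi3 hi2, integral_add hEi hi1, integral_const_mul,
    integral_add hgt hgi, integral_add hPi hPt, integral_add_right_eq_self g,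
    integral_add_right_eq_self P, hE, hP, integral_indicator_const' hIΩ,
    integral_indicator_const' hIP]
  have v1 := volume_real_prod_le (S := Ω) hIm
  have v2 := volume_real_prod_le (S := Ω \ S) hIm
  have v3 : 1 / ε * ((∫ p, g p) + ∫ p, g p) ≤ 2 * ε := by
    rw [one_div, inv_mul_le_iff₀ hε]
    nlinarith
  refine mul_le_mul_of_nonneg_left ?_ (by positivity)
  have v4 : ε / 2 * volume.real (I ×ˢ Ω : Set (SpaceTime d)) ≤ ε / 2 * (T * volume.real Ω) :=
    mul_le_mul_of_nonneg_left v1 (by positivity)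
  have v5 : 2 * B * volume.real (I ×ˢ (Ω \ S) : Set (SpaceTime d)) ≤
      2 * B * (T * volume.real (Ω \ S)) := mul_le_mul_of_nonneg_left v2 (by positivity)
  linarith

/-! ### Translations in time -/

/-- For monotone Lipschitz `b`, increments of `b(U) - w` squared are controlled by their product
with increments of `U`, up to increments of `w`. -/
lemma sq_increment_le {b : ℝ → ℝ} (hbm : Monotone b) {R L κ : ℝ} (hL : 0 ≤ L)
    (hbL : ∀ v w, |v| ≤ R → |w| ≤ R → |b v - b w| ≤ L * |v - w|) {v v' w w' : ℝ} (hv : |v| ≤ R)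
    (hv' : |v'| ≤ R) (hw : |w' - w| ≤ κ) :
    ((b v' - w') - (b v - w)) ^ 2 ≤
      (4 * L * R * κ + 2 * κ ^ 2) + 2 * L * (((b v' - w') - (b v - w)) * (v' - v)) := by
  set β := b v' - b v with hβ
  set e := w' - w with he
  set y := v' - v with hy
  have h1 : β ^ 2 ≤ L * (β * y) := by
    have h2 : |β| ≤ L * |y| := hbL _ _ hv' hv
    have h3 : 0 ≤ β * y := by
      rcases le_total v v' with h | h
      · exact mul_nonneg (sub_nonneg.2 (hbm h)) (sub_nonneg.2 h)
      · exact mul_nonneg_of_nonpos_of_nonpos (sub_nonpos.2 (hbm h)) (sub_nonpos.2 h)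
    calc β ^ 2 = |β| * |β| := by rw [← sq, sq_abs]
      _ ≤ |β| * (L * |y|) := mul_le_mul_of_nonneg_left h2 (abs_nonneg _)
      _ = L * |β * y| := by rw [abs_mul]; ring
      _ = _ := by rw [abs_of_nonneg h3]
  have h2 : (b v' - w') - (b v - w) = β - e := by simp only [hβ, he]; ring
  have h3 : e * y ≤ κ * (2 * R) := by
    have hy2 : |y| ≤ 2 * R := by
      rw [abs_le] at hv hv' ⊢; constructor <;> linarith
    calc e * y ≤ |e * y| := le_abs_self _
      _ = |e| * |y| := abs_mul _ _
      _ ≤ _ := mul_le_mul hw hy2 (abs_nonneg _) ((abs_nonneg _).trans hw)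
  have h4 : e ^ 2 ≤ κ ^ 2 := by
    rw [← sq_abs e]; exact pow_le_pow_left₀ (abs_nonneg _) hw 2
  rw [h2]
  -- From `(β-e)² ≤ 2β² + 2e²` and `2β² ≤ 2Lβy = 2L(β-e)y + 2Ley`: the first product is the one
  -- kept, and the last costs `4LRκ`.
  have h5 : L * (e * y) ≤ L * (κ * (2 * R)) := mul_le_mul_of_nonneg_left h3 hL
  nlinarith [sq_nonneg (β + e)]

set_option maxHeartbeats 400000 in
/-- Quantitative estimate of the translation in time of `γ = b(U) - w`. -/
lemma integral_sq_time_translate_le {T τ R B L ε δ K κ : ℝ} {Ω : Set (Space d)}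
    (hΩo : IsOpen Ω) (hΩb : Bornology.IsBounded Ω) (hτ0 : 0 < τ) (hτT : τ < T) (hR : 0 ≤ R)
    (hL : 0 ≤ L) (hε : 0 < ε) (hK0 : 0 ≤ K) (hκ0 : 0 ≤ κ)
    {b : ℝ → ℝ} (hbm : Monotone b) (hbL : ∀ v w, |v| ≤ R → |w| ≤ R → |b v - b w| ≤ L * |v - w|)
    {U γ w : SpaceTime d → ℝ} (hUm : Measurable U) (hγm : Measurable γ) (hUR : ∀ p, |U p| ≤ R)
    (hγB : ∀ p, |γ p| ≤ B) (hU0 : ∀ p ∉ cyl T Ω, U p = 0) (hγ0 : ∀ p ∉ cyl T Ω, γ p = 0)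
    (hγU : ∀ p ∈ cyl T Ω, γ p = b (U p) - w p)
    (hκ : ∀ p ∈ cyl T Ω, p + (τ, 0) ∈ cyl T Ω → |w (p + (τ, 0)) - w p| ≤ κ)
    (hsp : ∀ h : Space d, ‖h‖ < δ → ∫ p, (γ (p + (0, h)) - γ p) ^ 2 ≤ ε ^ 2)
    {ρ : Space d → ℝ} (hρc : Continuous ρ) (hρ : Integrable ρ) (hρ0 : ∀ x, 0 ≤ ρ x)
    (hρ1 : ∫ x, ρ x = 1) (hρδ : ∀ x, δ ≤ ‖x‖ → ρ x = 0)
    (hK : ∀ x₀, (∀ y ∉ Ω, ρ (y - x₀) = 0) → ∀ᵐ t : ℝ, t ∈ Ioo 0 T → t + τ ∈ Ioo 0 T →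
        |(∫ y, U (t + τ, y) * ρ (y - x₀)) - ∫ y, U (t, y) * ρ (y - x₀)| ≤ K * |τ|) :
    ∫ p, (γ (p + (τ, 0)) - γ p) ^ 2 ≤
      4 * B ^ 2 * (2 * τ * volume.real Ω + T * volume.real (Ω \ innerPart δ Ω)) +
      (4 * L * R * κ + 2 * κ ^ 2) * (T * volume.real Ω) +
      2 * L * (2 * R * (ε * (T * volume.real Ω / 2 + 2) +
        4 * B * T * volume.real (Ω \ innerPart δ Ω)) + K * τ * (2 * B * (T * volume.real Ω))) := by
  have hB : 0 ≤ B := (abs_nonneg _).trans (hγB 0)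
  set S := innerPart δ Ω with hS
  have hSm : MeasurableSet S := measurableSet_innerPart δ Ω
  have hSΩ : S ⊆ Ω := innerPart_subset δ Ω
  set I : Set ℝ := Ioo 0 (T - τ) with hI
  have hIm : volume.real I ≤ T := by
    rw [hI, Real.volume_real_Ioo_of_le (by linarith)]; linarith
  have hQ := volume_cyl_lt_top T hΩb
  set D : SpaceTime d → ℝ := fun p => γ (p + (τ, 0)) - γ p with hD
  have hDm : Measurable D := (hγm.comp (measurable_add_const _)).sub hγm
  have hDB : ∀ p, |D p| ≤ 2 * B := fun p => by
    have h1 := abs_le.1 (hγB (p + (τ, 0)))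
    have h2 := abs_le.1 (hγB p)
    exact abs_le.2 ⟨by simp only [hD]; linarith, by simp only [hD]; linarith⟩
  set V : SpaceTime d → ℝ := fun p => U (p + (τ, 0)) - U p with hV
  have hVm : Measurable V := (hUm.comp (measurable_add_const _)).sub hUm
  have hVR : ∀ p, |V p| ≤ 2 * R := fun p => by
    have h1 := abs_le.1 (hUR (p + (τ, 0)))
    have h2 := abs_le.1 (hUR p)
    exact abs_le.2 ⟨by simp only [hV]; linarith, by simp only [hV]; linarith⟩
  have hIS : MeasurableSet (I ×ˢ S : Set (SpaceTime d)) := measurableSet_Ioo.prod hSm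
  have hIΩ : MeasurableSet (I ×ˢ Ω : Set (SpaceTime d)) := measurableSet_Ioo.prod hΩo.measurableSet
  have hsub : (I ×ˢ Ω : Set (SpaceTime d)) ⊆ cyl T Ω :=
    prod_mono_left (Ioo_subset_Ioo_right (by linarith))
  have hIΩf : volume (I ×ˢ Ω : Set (SpaceTime d)) < ⊤ := (measure_mono hsub).trans_lt hQ
  have hISf : volume (I ×ˢ S : Set (SpaceTime d)) < ⊤ :=
    (measure_mono (prod_mono_right hSΩ)).trans_lt hIΩf
  set G : SpaceTime d → ℝ := (I ×ˢ S : Set (SpaceTime d)).indicator D with hG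
  have hGm : Measurable G := hDm.indicator hIS
  have hGB : ∀ p, |G p| ≤ (I ×ˢ S : Set (SpaceTime d)).indicator (fun _ => 2 * B) p := fun p => by
    by_cases hp : p ∈ (I ×ˢ S : Set (SpaceTime d))
    · rw [hG, indicator_of_mem hp, indicator_of_mem hp]; exact hDB p
    · rw [hG, indicator_of_notMem hp, indicator_of_notMem hp, abs_zero]
  have hSi := integrable_indicator_const hIS hISf (2 * B)
  have hGi : Integrable G := Integrable.mono' hSi hGm.aestronglyMeasurable
    (Eventually.of_forall hGB)
  have hGint : ∫ p, |G p| ≤ 2 * B * (T * volume.real Ω) := by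
    refine (integral_mono hGi.abs hSi hGB).trans ?_
    rw [integral_indicator_const' hIS]
    refine mul_le_mul_of_nonneg_left ((volume_real_prod_le hIm).trans ?_) (by positivity)
    exact mul_le_mul_of_nonneg_left (measureReal_mono hSΩ hΩb.measure_lt_top.ne)
      (by linarith : (0 : ℝ) ≤ T)
  have hpair : |∫ p, G p * V p| ≤ 2 * R * (ε * (T * volume.real Ω / 2 + 2) +
        4 * B * T * volume.real (Ω \ S)) + K * τ * ∫ p, |G p| := by
    refine abs_integral_mul_le_of_average hGi hVm hVR hρ hρ0 hρ1 hρδ (fun h hh => ?_) ?_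
    · exact abs_pairing_sub_translate_le hΩo hΩb hτ0 hτT hR hε hSm hSΩ hUm hγm hUR hγB hU0 hγ0
        (fun p => rfl) hG (hsp (-h) (by rwa [norm_neg]))
    · filter_upwards [ae_abs_average_le hUm hUR hρc hρ hρδ hK] with p hp hGp
      have hmem : p ∈ (I ×ˢ S : Set (SpaceTime d)) := by
        by_contra hcon
        exact hGp (indicator_of_notMem hcon _)
      have h1 := hp ⟨hmem.1.1, by linarith [hmem.1.2]⟩
        ⟨by linarith [hmem.1.1], by linarith [hmem.1.2]⟩ hmem.2
      rwa [abs_of_pos hτ0] at h1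
  -- Off `I × S` the increment `D` can be nonzero only in the two end strips of duration `τ` and the
  -- lateral strip over `Ω \ S`; there the crude bound `D² ≤ (2B)²` suffices.
  set N₁ : Set (SpaceTime d) := Ioc (-τ) 0 ×ˢ Ω with hN₁
  set N₂ : Set (SpaceTime d) := Ico (T - τ) T ×ˢ Ω with hN₂
  set N₃ : Set (SpaceTime d) := Ioo 0 T ×ˢ (Ω \ S) with hN₃
  have hm1 : MeasurableSet N₁ := measurableSet_Ioc.prod hΩo.measurableSet
  have hm2 : MeasurableSet N₂ := measurableSet_Ico.prod hΩo.measurableSet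
  have hm3 : MeasurableSet N₃ := measurableSet_Ioo.prod (hΩo.measurableSet.diff hSm)
  have hf : ∀ (J : Set ℝ) (X : Set (Space d)), volume J < ⊤ → X ⊆ Ω →
      volume (J ×ˢ X : Set (SpaceTime d)) < ⊤ := by
    intro J X hJ hX
    rw [Measure.volume_eq_prod, Measure.prod_prod]
    exact ENNReal.mul_lt_top hJ ((measure_mono hX).trans_lt hΩb.measure_lt_top)
  have hf1 : volume N₁ < ⊤ := hf _ _ measure_Ioc_lt_top le_rfl
  have hf2 : volume N₂ < ⊤ := hf _ _ measure_Ico_lt_top le_rfl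
  have hf3 : volume N₃ < ⊤ := hf _ _ measure_Ioo_lt_top sdiff_subset
  set c := 4 * B ^ 2 with hc
  set c' := 4 * L * R * κ + 2 * κ ^ 2 with hc'
  have hc0 : 0 ≤ c := by positivity
  have hc'0 : 0 ≤ c' := by positivity
  have hpt : ∀ p, D p ^ 2 ≤ (N₁.indicator (fun _ => c) p + N₂.indicator (fun _ => c) p +
      N₃.indicator (fun _ => c) p) + (I ×ˢ Ω : Set (SpaceTime d)).indicator (fun _ => c') p +
      2 * L * (G p * V p) := by
    intro p
    have p1 : 0 ≤ N₁.indicator (fun _ => c) p := indicator_nonneg (fun _ _ => hc0) p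
    have p2 : 0 ≤ N₂.indicator (fun _ => c) p := indicator_nonneg (fun _ _ => hc0) p
    have p3 : 0 ≤ N₃.indicator (fun _ => c) p := indicator_nonneg (fun _ _ => hc0) p
    have p4 : 0 ≤ (I ×ˢ Ω : Set (SpaceTime d)).indicator (fun _ => c') p :=
      indicator_nonneg (fun _ _ => hc'0) p
    by_cases hp : p ∈ (I ×ˢ S : Set (SpaceTime d))
    · have hpΩ : p ∈ (I ×ˢ Ω : Set (SpaceTime d)) := ⟨hp.1, hSΩ hp.2⟩
      have hpQ : p ∈ cyl T Ω := hsub hpΩ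
      have hpQ' : p + (τ, 0) ∈ cyl T Ω :=
        ⟨⟨by simpa using by linarith [hp.1.1], by simpa using by linarith [hp.1.2]⟩,
          by simpa using hSΩ hp.2⟩
      rw [indicator_of_mem hpΩ, hG, indicator_of_mem hp]
      have := sq_increment_le hbm hL hbL (hUR p) (hUR (p + (τ, 0))) (hκ p hpQ hpQ')
      rw [← hγU p hpQ, ← hγU _ hpQ'] at this
      simp only [hD, hV]
      linarith
    · rw [hG, indicator_of_notMem hp, zero_mul, mul_zero, add_zero]
      have hDc : D p ^ 2 ≤ c := by
        rw [← sq_abs, hc, show 4 * B ^ 2 = (2 * B) ^ 2 by ring]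
        exact pow_le_pow_left₀ (abs_nonneg _) (hDB p) 2
      by_cases h1 : p ∈ N₁
      · rw [indicator_of_mem h1]; linarith
      by_cases h2 : p ∈ N₂
      · rw [indicator_of_mem h2]; linarith
      by_cases h3 : p ∈ N₃
      · rw [indicator_of_mem h3]; linarith
      have hz : D p = 0 := by
        have hor : p ∉ cyl T Ω ∧ p + (τ, 0) ∉ cyl T Ω := by
          by_cases hx : p.2 ∈ Ω
          swap
          · exact ⟨fun h => hx h.2, fun h => hx (by simpa using h.2)⟩
          have ht : ¬ (-τ < p.1 ∧ p.1 < T) := by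
            rintro ⟨ha, hb⟩
            rcases le_or_gt p.1 0 with h0 | h0
            · exact h1 ⟨⟨ha, h0⟩, hx⟩
            rcases le_or_gt (T - τ) p.1 with h0' | h0'
            · exact h2 ⟨⟨h0', hb⟩, hx⟩
            by_cases hxS : p.2 ∈ S
            · exact hp ⟨⟨h0, h0'⟩, hxS⟩
            · exact h3 ⟨⟨h0, hb⟩, hx, hxS⟩
          refine ⟨fun h => ht ⟨by linarith [h.1.1], h.1.2⟩, fun h => ht ?_⟩
          have h4 := h.1
          simp only [Prod.fst_add, mem_Ioo] at h4
          exact ⟨by linarith [h4.1], by linarith [h4.2]⟩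
        simp only [hD]
        rw [hγ0 _ hor.1, hγ0 _ hor.2, sub_zero]
      rw [hz]
      have : (0 : ℝ) ^ 2 = 0 := by norm_num
      linarith
  have i1 := integrable_indicator_const hm1 hf1 c
  have i2 := integrable_indicator_const hm2 hf2 c
  have i3 := integrable_indicator_const hm3 hf3 c
  have i4 := integrable_indicator_const hIΩ hIΩf c'
  have i5 : Integrable fun p => G p * V p :=
    hGi.mul_bdd (c := 2 * R) hVm.aestronglyMeasurable (Eventually.of_forall hVR)
  have i6 : Integrable fun p => 2 * L * (G p * V p) := i5.const_mul _
  have i12 : Integrable fun p => N₁.indicator (fun _ => c) p + N₂.indicator (fun _ => c) p :=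
    i1.add i2
  have i123 : Integrable fun p => N₁.indicator (fun _ => c) p + N₂.indicator (fun _ => c) p +
      N₃.indicator (fun _ => c) p := i12.add i3
  have i1234 : Integrable fun p => N₁.indicator (fun _ => c) p + N₂.indicator (fun _ => c) p +
      N₃.indicator (fun _ => c) p + (I ×ˢ Ω : Set (SpaceTime d)).indicator (fun _ => c') p :=
    i123.add i4
  have iall : Integrable fun p => N₁.indicator (fun _ => c) p + N₂.indicator (fun _ => c) p +
      N₃.indicator (fun _ => c) p + (I ×ˢ Ω : Set (SpaceTime d)).indicator (fun _ => c') p +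
      2 * L * (G p * V p) := i1234.add i6
  have hfin := integral_mono_of_nonneg (Eventually.of_forall fun p => sq_nonneg (D p)) iall
    (Eventually.of_forall hpt)
  refine hfin.trans ?_
  rw [integral_add i1234 i6, integral_add i123 i4, integral_add i12 i3, integral_add i1 i2,
    integral_const_mul, integral_indicator_const' hm1, integral_indicator_const' hm2,
    integral_indicator_const' hm3, integral_indicator_const' hIΩ]
  have w1 : volume.real N₁ ≤ τ * volume.real Ω :=
    volume_real_prod_le (by rw [Real.volume_real_Ioc_of_le (by linarith)]; linarith)
  have w2 : volume.real N₂ ≤ τ * volume.real Ω :=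
    volume_real_prod_le (by rw [Real.volume_real_Ico_of_le (by linarith)]; linarith)
  have w3 : volume.real N₃ ≤ T * volume.real (Ω \ S) :=
    volume_real_prod_le (by rw [Real.volume_real_Ioo_of_le (by linarith)]; linarith)
  have w4 : volume.real (I ×ˢ Ω : Set (SpaceTime d)) ≤ T * volume.real Ω := volume_real_prod_le hIm
  have w5 : (∫ p, G p * V p) ≤ 2 * R * (ε * (T * volume.real Ω / 2 + 2) +
        4 * B * T * volume.real (Ω \ S)) + K * τ * (2 * B * (T * volume.real Ω)) :=
    (le_abs_self _).trans (hpair.trans (by gcongr))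
  have y1 := mul_le_mul_of_nonneg_left w1 hc0
  have y2 := mul_le_mul_of_nonneg_left w2 hc0
  have y3 := mul_le_mul_of_nonneg_left w3 hc0
  have y4 := mul_le_mul_of_nonneg_left w4 hc'0
  have y5 := mul_le_mul_of_nonneg_left w5 (by positivity : 0 ≤ 2 * L)
  linarith

lemma mul_div_add_one_le {c ε : ℝ} (hc : 0 ≤ c) (hε : 0 ≤ ε) : c * (ε / (c + 1)) ≤ ε := by
  rw [mul_div_assoc', div_le_iff₀ (by linarith)]
  nlinarith

/-- Equicontinuity with respect to translations in space implies equicontinuity with respect to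
translations in time for `γ = b(U) - w`, if spatial averages of `U` are Lipschitz in time. -/
theorem exists_integral_sq_time_translate_le {ι : Type*} {T R B L : ℝ} {Ω : Set (Space d)}
    (hT : 0 < T) (hΩo : IsOpen Ω) (hΩb : Bornology.IsBounded Ω) (hR : 0 ≤ R) (hL : 0 ≤ L)
    (hB : 0 ≤ B) {b : ℝ → ℝ} (hbm : Monotone b)
    (hbL : ∀ v w, |v| ≤ R → |w| ≤ R → |b v - b w| ≤ L * |v - w|)
    {w : SpaceTime d → ℝ} (hw : ContinuousOn w (Icc 0 T ×ˢ univ))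
    {U γ : ι → SpaceTime d → ℝ} (hUm : ∀ i, Measurable (U i)) (hγm : ∀ i, Measurable (γ i))
    (hUR : ∀ i p, |U i p| ≤ R) (hγB : ∀ i p, |γ i p| ≤ B) (hU0 : ∀ i, ∀ p ∉ cyl T Ω, U i p = 0)
    (hγ0 : ∀ i, ∀ p ∉ cyl T Ω, γ i p = 0)
    (hγU : ∀ i, ∀ p ∈ cyl T Ω, γ i p = b (U i p) - w p)
    (hsp : ∀ ε > 0, ∃ η > 0, ∀ h : Space d, ‖h‖ < η →
      ∀ i, ∫ p, (γ i (p + (0, h)) - γ i p) ^ 2 ≤ ε ^ 2)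
    (havg : ∀ δ > 0, ∃ ρ : Space d → ℝ, Continuous ρ ∧ Integrable ρ ∧ (∀ x, 0 ≤ ρ x) ∧
      ∫ x, ρ x = 1 ∧ (∀ x, δ ≤ ‖x‖ → ρ x = 0) ∧ ∃ K, 0 ≤ K ∧ ∀ i x₀,
        (∀ y ∉ Ω, ρ (y - x₀) = 0) → ∀ τ : ℝ, ∀ᵐ t : ℝ, t ∈ Ioo 0 T → t + τ ∈ Ioo 0 T →
        |(∫ y, U i (t + τ, y) * ρ (y - x₀)) - ∫ y, U i (t, y) * ρ (y - x₀)| ≤ K * |τ|) :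
    ∀ ε > 0, ∃ η > 0, ∀ τ : ℝ, |τ| < η → ∀ i, ∫ p, (γ i (p + (τ, 0)) - γ i p) ^ 2 ≤ ε := by
  intro ε hε
  set vol := volume.real Ω with hvol
  have hvol0 : 0 ≤ vol := measureReal_nonneg
  have hε5 : 0 < ε / 5 := by positivity
  -- `c₁, …, c₄` are the coefficients of `τ`, `|Ω \ innerPart δ Ω|`, `κ` and `ε'` in
  -- `integral_sq_time_translate_le` (using `κ² ≤ κ`), and `c₅` that of `Kτ`. The order of choice
  -- matters: `ε'` determines `δ`, `δ` determines `ρ` and `K`, and only then is `η` taken small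
  -- against `K`.
  set c₁ := 8 * B ^ 2 * vol with hc₁
  set c₂ := 4 * B ^ 2 * T + 2 * L * (2 * R * (4 * B * T)) with hc₂
  set c₃ := (4 * L * R + 2) * (T * vol) with hc₃
  set c₄ := 2 * L * (2 * R * (T * vol / 2 + 2)) with hc₄
  set c₅ := 2 * L * (2 * B * (T * vol)) with hc₅
  have hc₁0 : 0 ≤ c₁ := by positivity
  have hc₂0 : 0 ≤ c₂ := by positivity
  have hc₃0 : 0 ≤ c₃ := by positivity
  have hc₄0 : 0 ≤ c₄ := by positivity
  have hc₅0 : 0 ≤ c₅ := by positivity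
  set ε' := ε / 5 / (c₄ + 1) with hε'
  have hε'0 : 0 < ε' := by positivity
  obtain ⟨η₀, hη₀, hsp'⟩ := hsp ε' hε'0
  obtain ⟨δ₁, hδ₁, hδ⟩ := Metric.tendsto_nhds_nhds.1 (tendsto_volume_diff_innerPart hΩo hΩb)
    (ε / 5 / (c₂ + 1)) (by positivity)
  set δ := min η₀ (δ₁ / 2) with hδdef
  have hδ0 : 0 < δ := by positivity
  have hδv : volume.real (Ω \ innerPart δ Ω) ≤ ε / 5 / (c₂ + 1) := by
    have h1 := hδ (x := δ) (by
      rw [Real.dist_eq, sub_zero, abs_of_pos hδ0]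
      exact (min_le_right _ _).trans_lt (by linarith))
    rw [Real.dist_eq, sub_zero] at h1
    exact (le_abs_self _).trans h1.le
  obtain ⟨ρ, hρc, hρ, hρ0, hρ1, hρδ, K, hK0, hK⟩ := havg δ hδ0
  set κ := min 1 (ε / 5 / (c₃ + 1)) with hκ
  have hκ0 : 0 < κ := by positivity
  have huc := ((isCompact_Icc (a := (0 : ℝ)) (b := T)).prod
    hΩb.isCompact_closure).uniformContinuousOn_of_continuous
      (hw.mono (prod_mono_right (subset_univ (closure Ω))))
  obtain ⟨η₁, hη₁, hw1⟩ := Metric.uniformContinuousOn_iff.1 huc κ hκ0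
  set η := min T (min η₁ (ε / 5 / (c₁ + c₅ * K + 1) )) with hη
  have hc15 : 0 ≤ c₁ + c₅ * K := by positivity
  have hη0 : 0 < η := by positivity
  have hpos : ∀ τ : ℝ, 0 < τ → τ < η → ∀ i, ∫ p, (γ i (p + (τ, 0)) - γ i p) ^ 2 ≤ ε := by
    intro τ hτ0 hτ i
    have hτT : τ < T := hτ.trans_le (min_le_left _ _)
    have hτ1 : τ < η₁ := hτ.trans_le ((min_le_right _ _).trans (min_le_left _ _))
    have hτ2 : τ ≤ ε / 5 / (c₁ + c₅ * K + 1) :=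
      (hτ.trans_le ((min_le_right _ _).trans (min_le_right _ _))).le
    have hmem : ∀ p ∈ cyl T Ω, p ∈ Icc 0 T ×ˢ closure Ω := fun p hp =>
      ⟨Ioo_subset_Icc_self hp.1, subset_closure hp.2⟩
    have h := integral_sq_time_translate_le hΩo hΩb hτ0 hτT hR hL hε'0 hK0 hκ0.le hbm hbL (hUm i)
      (hγm i) (hUR i) (hγB i) (hU0 i) (hγ0 i) (hγU i) (κ := κ) (fun p hp hp' => by
        refine (hw1 _ (hmem _ hp') _ (hmem _ hp) ?_).le
        rw [dist_eq_norm, add_sub_cancel_left, Prod.norm_mk, norm_zero, Real.norm_eq_abs,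
          abs_of_pos hτ0, max_eq_left hτ0.le]
        exact hτ1) (δ := δ)
      (fun h hh => hsp' h (hh.trans_le (min_le_left _ _)) i) hρc hρ hρ0 hρ1 hρδ
      (fun x₀ hx => hK i x₀ hx τ)
    refine h.trans ?_
    rw [← hvol]
    set m := volume.real (Ω \ innerPart δ Ω) with hm
    have hκsq : κ ^ 2 ≤ κ := by nlinarith [min_le_left 1 (ε / 5 / (c₃ + 1))]
    have t1 : (c₁ + c₅ * K) * τ ≤ ε / 5 :=
      (mul_le_mul_of_nonneg_left hτ2 hc15).trans (mul_div_add_one_le hc15 hε5.le)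
    have t2 : c₂ * m ≤ ε / 5 :=
      (mul_le_mul_of_nonneg_left hδv hc₂0).trans (mul_div_add_one_le hc₂0 hε5.le)
    have t3 : c₃ * κ ≤ ε / 5 :=
      (mul_le_mul_of_nonneg_left (min_le_right _ _) hc₃0).trans (mul_div_add_one_le hc₃0 hε5.le)
    have t4 : c₄ * ε' ≤ ε / 5 := mul_div_add_one_le hc₄0 hε5.le
    have t5 : (4 * L * R * κ + 2 * κ ^ 2) * (T * vol) ≤ c₃ * κ := by
      rw [hc₃]
      have : (4 * L * R * κ + 2 * κ ^ 2) ≤ (4 * L * R + 2) * κ := by linarith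
      calc _ ≤ (4 * L * R + 2) * κ * (T * vol) :=
            mul_le_mul_of_nonneg_right this (by positivity)
        _ = _ := by ring
    have t6 : 4 * B ^ 2 * (2 * τ * vol + T * m) + 2 * L * (2 * R * (ε' * (T * vol / 2 + 2) +
        4 * B * T * m) + K * τ * (2 * B * (T * vol))) =
        (c₁ + c₅ * K) * τ + c₂ * m + c₄ * ε' := by
      simp only [hc₁, hc₂, hc₄, hc₅]; ring
    linarith
  refine ⟨η, hη0, fun τ hτ i => ?_⟩
  rcases lt_trichotomy τ 0 with h | rfl | h
  -- Negative `τ` reduces to positive by translation invariance of the integral.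
  · have h1 := hpos (-τ) (by linarith) (by rwa [abs_of_neg h] at hτ) i
    rw [← integral_add_right_eq_self _ ((τ, 0) : SpaceTime d)] at h1
    refine le_trans (le_of_eq ?_) h1
    congr 1
    funext p
    have : p + (τ, 0) + (-τ, 0) = p := by ext <;> simp
    rw [this]; ring
  · have : ((0 : ℝ), (0 : Space d)) = 0 := rfl
    simp only [this, add_zero, sub_self]
    simpa using hε.le
  · exact hpos τ h (by rwa [abs_of_pos h] at hτ) i

/-! ### Kolmogorov–Riesz compactness -/

section TotallyBounded

variable {E : Type*} [NormedAddCommGroup E] [NormedSpace ℝ E] [FiniteDimensional ℝ E]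

/-- Uniformly bounded, equi-Lipschitz functions are totally bounded for uniform convergence on
bounded sets. -/
lemma exists_finite_net_of_lipschitz {ι : Type*} [Nonempty ι] {F : ι → E → ℝ} {B K : ℝ} (hK : 0 ≤ K)
    (hB : ∀ i p, |F i p| ≤ B) (hL : ∀ i p q, |F i p - F i q| ≤ K * ‖p - q‖) {Q : Set E}
    (hQ : Bornology.IsBounded Q) {s : ℝ} (hs : 0 < s) :
    ∃ t : Set ι, t.Finite ∧ ∀ i, ∃ j ∈ t, ∀ p ∈ Q, |F i p - F j p| ≤ s := by
  have hQt : TotallyBounded Q := (hQ.isCompact_closure.totallyBounded).subset subset_closure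
  obtain ⟨c, hc, hcQ⟩ := Metric.totallyBounded_iff.1 hQt (s / 3 / (K + 1)) (by positivity)
  have : Fintype c := hc.fintype
  -- Sampling at a finite net of `Q` gives a bounded set in a finite-dimensional space, hence a
  -- totally bounded one; the Lipschitz bound extends closeness from the net to `Q`.
  set V : ι → (c → ℝ) := fun i x => F i x with hV
  have hVb : Bornology.IsBounded (range V) := by
    refine isBounded_iff_forall_norm_le.2 ⟨|B|, ?_⟩
    rintro _ ⟨i, rfl⟩
    exact (pi_norm_le_iff_of_nonneg (abs_nonneg B)).2 fun x => (hB i x).trans (le_abs_self B)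
  have hVt : TotallyBounded (range V) := (hVb.isCompact_closure.totallyBounded).subset subset_closure
  obtain ⟨t', ht'V, ht'f, ht'⟩ := totallyBounded_iff_subset.1 hVt _
    (Metric.dist_mem_uniformity (show 0 < s / 3 by positivity))
  have hpre : ∀ y ∈ t', ∃ i, V i = y := fun y hy => ht'V hy
  choose! ψ hψ using hpre
  refine ⟨ψ '' t', ht'f.image ψ, fun i => ?_⟩
  obtain ⟨y, hy, hiy⟩ := mem_iUnion₂.1 (ht' ⟨i, rfl⟩)
  refine ⟨ψ y, mem_image_of_mem ψ hy, fun p hp => ?_⟩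
  obtain ⟨x, hx, hpx⟩ := mem_iUnion₂.1 (hcQ hp)
  have h1 : |F i x - F (ψ y) x| ≤ s / 3 := by
    have h2 : dist (V i) y < s / 3 := hiy
    rw [← hψ y hy] at h2
    exact ((dist_le_pi_dist (V i) (V (ψ y)) ⟨x, hx⟩).trans h2.le)
  have h2 : K * ‖p - x‖ ≤ s / 3 := by
    rw [Metric.mem_ball, dist_eq_norm] at hpx
    refine (mul_le_mul_of_nonneg_left hpx.le hK).trans ?_
    rw [mul_div_assoc', div_le_iff₀ (by linarith)]
    nlinarith
  have h3 := (hL i p x).trans h2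
  have h4 := (hL (ψ y) p x).trans h2
  rw [abs_le] at h1 h3 h4 ⊢
  constructor <;> linarith

variable [MeasurableSpace E] [BorelSpace E] {ν : Measure E} [ν.IsAddHaarMeasure]

/-- Mollification moves a function in `L²` at most by its largest translation. -/
lemma integral_sq_average_sub_le {g : E → ℝ} (hg : Measurable g) {B : ℝ} (hgB : ∀ p, |g p| ≤ B)
    {Q : Set E} (hQ : ν Q < ⊤) {k : E → ℝ} (hk : Integrable k ν)
    (hk0 : ∀ q, 0 ≤ k q) (hk1 : ∫ q, k q ∂ν = 1) {η ε : ℝ} (hkη : ∀ q, η ≤ ‖q‖ → k q = 0)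
    (h : ∀ q, ‖q‖ < η → ∫ p in Q, (g (p + q) - g p) ^ 2 ∂ν ≤ ε) :
    ∫ p in Q, ((∫ q, k q * g (p + q) ∂ν) - g p) ^ 2 ∂ν ≤ ε := by
  have : IsFiniteMeasure (ν.restrict Q) := isFiniteMeasure_restrict.2 hQ.ne
  have hD : ∀ p q, |g (p + q) - g p| ≤ 2 * B := fun p q => by
    have h1 := abs_le.1 (hgB (p + q)); have h2 := abs_le.1 (hgB p)
    exact abs_le.2 ⟨by linarith, by linarith⟩
  have hD2 : ∀ p q, |(g (p + q) - g p) ^ 2| ≤ (2 * B) ^ 2 := fun p q => by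
    rw [abs_pow]; exact pow_le_pow_left₀ (abs_nonneg _) (hD p q) 2
  have hi1 : ∀ p, Integrable (fun q => k q * g (p + q)) ν := fun p =>
    hk.mul_bdd (c := B) (hg.comp (measurable_const_add p)).aestronglyMeasurable
      (Eventually.of_forall fun q => hgB _)
  have hi2 : ∀ p, Integrable (fun q => k q * (g (p + q) - g p)) ν := fun p =>
    hk.mul_bdd (c := 2 * B) ((hg.comp (measurable_const_add p)).sub_const _).aestronglyMeasurable
      (Eventually.of_forall fun q => hD p q)
  have hi3 : ∀ p, Integrable (fun q => k q * (g (p + q) - g p) ^ 2) ν := fun p =>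
    hk.mul_bdd (c := (2 * B) ^ 2)
      (((hg.comp (measurable_const_add p)).sub_const _).pow_const 2).aestronglyMeasurable
      (Eventually.of_forall fun q => hD2 p q)
  have hprod : Integrable (fun a : E × E => k a.2 * (g (a.1 + a.2) - g a.1) ^ 2)
      ((ν.restrict Q).prod ν) := by
    have h1 : Integrable (fun a : E × E => (1 : ℝ) * k a.2) ((ν.restrict Q).prod ν) :=
      (integrable_const (1 : ℝ)).mul_prod hk
    simp only [one_mul] at h1
    refine h1.mul_bdd (c := (2 * B) ^ 2) ?_ (Eventually.of_forall fun a => hD2 a.1 a.2)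
    exact (((hg.comp (measurable_fst.add measurable_snd)).sub
      (hg.comp measurable_fst)).pow_const 2).aestronglyMeasurable
  have hpt : ∀ p, ((∫ q, k q * g (p + q) ∂ν) - g p) ^ 2 ≤
      ∫ q, k q * (g (p + q) - g p) ^ 2 ∂ν := by
    intro p
    set m := (∫ q, k q * g (p + q) ∂ν) - g p with hm
    have hm1 : ∫ q, k q * (g (p + q) - g p) ∂ν = m := by
      have : ∀ q, k q * (g (p + q) - g p) = k q * g (p + q) - k q * g p := fun q => by ring
      simp_rw [this]
      rw [integral_sub (hi1 p) (hk.mul_const _), integral_mul_const, hk1, one_mul]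
    -- Jensen's inequality for the probability density `k`, as nonnegativity of a variance.
    have h0 : 0 ≤ ∫ q, k q * ((g (p + q) - g p) - m) ^ 2 ∂ν :=
      integral_nonneg fun q => mul_nonneg (hk0 q) (sq_nonneg _)
    have h1 : ∀ q, k q * ((g (p + q) - g p) - m) ^ 2 =
        k q * (g (p + q) - g p) ^ 2 - 2 * m * (k q * (g (p + q) - g p)) + k q * m ^ 2 :=
      fun q => by ring
    simp_rw [h1] at h0
    have h2 : Integrable (fun q => k q * (g (p + q) - g p) ^ 2 -
        2 * m * (k q * (g (p + q) - g p))) ν := (hi3 p).sub ((hi2 p).const_mul _)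
    rw [integral_add h2 (hk.mul_const _), integral_sub (hi3 p) ((hi2 p).const_mul _),
      integral_const_mul, integral_mul_const, hk1, hm1] at h0
    linarith
  calc ∫ p in Q, ((∫ q, k q * g (p + q) ∂ν) - g p) ^ 2 ∂ν
      ≤ ∫ p in Q, ∫ q, k q * (g (p + q) - g p) ^ 2 ∂ν ∂ν :=
        integral_mono_of_nonneg (Eventually.of_forall fun p => sq_nonneg _)
          hprod.integral_prod_left (Eventually.of_forall hpt)
    _ = ∫ q, k q * ∫ p in Q, (g (p + q) - g p) ^ 2 ∂ν ∂ν := by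
        rw [integral_integral_swap (f := fun p q => k q * (g (p + q) - g p) ^ 2) hprod]
        simp_rw [integral_const_mul]
    _ ≤ ∫ q, k q * ε ∂ν := by
        refine integral_mono_of_nonneg
          (Eventually.of_forall fun q => mul_nonneg (hk0 q) (integral_nonneg fun p => sq_nonneg _))
          (hk.mul_const ε) (Eventually.of_forall fun q => ?_)
        rcases lt_or_ge ‖q‖ η with hlt | hge
        · exact mul_le_mul_of_nonneg_left (h q hlt) (hk0 q)
        · simp [hkη q hge]
    _ = ε := by rw [integral_mul_const, hk1, one_mul]

/-- Bounded functions supported in a common bounded set which are equicontinuous in `L²` with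
respect to translations are totally bounded in `L²`. -/
theorem exists_finite_net_of_translate {ι : Type*} {γ : ι → E → ℝ} {B : ℝ}
    (hγm : ∀ i, Measurable (γ i)) (hγB : ∀ i p, |γ i p| ≤ B) {Q : Set E}
    (hQm : MeasurableSet Q) (hQb : Bornology.IsBounded Q) (hγ0 : ∀ i, ∀ p ∉ Q, γ i p = 0)
    (h : ∀ ε > 0, ∃ η > 0, ∀ q, ‖q‖ < η → ∀ i, ∫ p, (γ i (p + q) - γ i p) ^ 2 ∂ν ≤ ε) :
    ∀ ε > 0, ∃ t : Set ι, t.Finite ∧ ∀ i, ∃ j ∈ t, ∫ p in Q, (γ i p - γ j p) ^ 2 ∂ν ≤ ε := by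
  intro ε hε
  rcases isEmpty_or_nonempty ι with hι | hι
  · exact ⟨∅, finite_empty, fun i => (hι.false i).elim⟩
  have hB0 : 0 ≤ B := (abs_nonneg _).trans (hγB (Classical.arbitrary ι) 0)
  have hQ : ν Q < ⊤ := hQb.measure_lt_top
  have : IsFiniteMeasure (ν.restrict Q) := isFiniteMeasure_restrict.2 hQ.ne
  have hγi : ∀ i, Integrable (γ i) ν := fun i =>
    (integrableOn_iff_integrable_of_support_subset fun p hp => by
      by_contra hcon
      exact hp (hγ0 i p hcon)).1 (IntegrableOn.of_bound hQ (hγm i).aestronglyMeasurable B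
        (Eventually.of_forall (hγB i)))
  -- `γ i - γ j` splits into two mollification errors and a difference of mollified functions. The
  -- square of a sum of three terms costs a factor `3`, so each may contribute `ε / 9`.
  obtain ⟨η, hη, hηq⟩ := h (ε / 9) (by positivity)
  let φ : ContDiffBump (0 : E) := ⟨η / 2, η, by positivity, by linarith⟩
  set k : E → ℝ := φ.normed ν with hk
  have hki : Integrable k ν := φ.integrable_normed
  obtain ⟨K, hK⟩ := ContDiff.lipschitzWith_of_hasCompactSupport
    (φ.hasCompactSupport_normed (μ := ν)) (φ.contDiff_normed (n := 1)) (by simp)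
  have hkη : ∀ q, η ≤ ‖q‖ → k q = 0 := fun q hq => by
    have : q ∉ Function.support k := by
      rw [hk, φ.support_normed_eq, Metric.mem_ball, dist_zero_right]
      exact not_lt.2 hq
    simpa using this
  set F : ι → E → ℝ := fun i p => ∫ q, k q * γ i (p + q) ∂ν with hF
  have hsq : ∀ i q, Integrable (fun p => (γ i (p + q) - γ i p) ^ 2) ν := fun i q => by
    have h1 : Integrable (fun p => γ i (p + q) - γ i p) ν := ((hγi i).comp_add_right q).sub (hγi i)
    simp only [sq]
    refine h1.mul_bdd (c := 2 * B) h1.1 (Eventually.of_forall fun p => ?_)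
    have h1 := abs_le.1 (hγB i (p + q)); have h2 := abs_le.1 (hγB i p)
    exact abs_le.2 ⟨by linarith, by linarith⟩
  have hFγ : ∀ i, ∫ p in Q, (F i p - γ i p) ^ 2 ∂ν ≤ ε / 9 := fun i =>
    integral_sq_average_sub_le (hγm i) (hγB i) hQ hki (fun q => φ.nonneg_normed q)
      φ.integral_normed hkη fun q hq => (setIntegral_le_integral (hsq i q)
        (Eventually.of_forall fun p => sq_nonneg _)).trans (hηq q hq i)
  have hFB : ∀ i p, |F i p| ≤ B := by
    intro i p
    have h1 : ∫ q, k q * B ∂ν = B := by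
      rw [integral_mul_const, hk, φ.integral_normed, one_mul]
    rw [← Real.norm_eq_abs]
    conv_rhs => rw [← h1]
    refine norm_integral_le_of_norm_le (hki.mul_const B) (Eventually.of_forall fun q => ?_)
    rw [norm_mul, Real.norm_of_nonneg (φ.nonneg_normed q)]
    exact mul_le_mul_of_nonneg_left (hγB i _) (φ.nonneg_normed q)
  -- With `p` in the kernel, the Lipschitz constant of `F i` comes from `k` and is uniform in `i`.
  have hFeq : ∀ i p, F i p = ∫ q, k (q - p) * γ i q ∂ν := fun i p => by
    rw [← integral_add_left_eq_self (fun q => k (q - p) * γ i q) p]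
    simp only [hF, add_sub_cancel_left]
  have hFi : ∀ i p, Integrable (fun q => k (q - p) * γ i q) ν := fun i p =>
    (hki.comp_sub_right p).mul_bdd (c := B) (hγm i).aestronglyMeasurable
      (Eventually.of_forall (hγB i))
  have hFL : ∀ i p p', |F i p - F i p'| ≤ (K * B * ν.real Q) * ‖p - p'‖ := by
    intro i p p'
    rw [hFeq, hFeq, ← integral_sub (hFi i p) (hFi i p'), ← Real.norm_eq_abs]
    have h1 : ∫ q, Q.indicator (fun _ => K * ‖p - p'‖ * B) q ∂ν = (K * B * ν.real Q) * ‖p - p'‖ := by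
      rw [integral_indicator_const _ hQm, smul_eq_mul]; ring
    rw [← h1]
    refine norm_integral_le_of_norm_le ((integrable_indicator_iff hQm).2 (integrableOn_const hQ.ne))
      (Eventually.of_forall fun q => ?_)
    by_cases hq : q ∈ Q
    · rw [indicator_of_mem hq, ← sub_mul, norm_mul]
      refine mul_le_mul ?_ (hγB i q) (norm_nonneg _) (by positivity)
      have h2 := hK.dist_le_mul (q - p) (q - p')
      rwa [dist_eq_norm, dist_eq_norm, sub_sub_sub_cancel_left, norm_sub_rev p' p] at h2
    · rw [indicator_of_notMem hq, hγ0 i q hq]; simp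
  set s : ℝ := Real.sqrt (ε / 9 / (ν.real Q + 1)) with hs
  have hs0 : 0 < s := Real.sqrt_pos.2 (by positivity)
  obtain ⟨t, htf, ht⟩ := exists_finite_net_of_lipschitz (by positivity) hFB hFL hQb hs0
  refine ⟨t, htf, fun i => ?_⟩
  obtain ⟨j, hj, hij⟩ := ht i
  refine ⟨j, hj, ?_⟩
  have hFm : ∀ i, Continuous (F i) := fun i =>
    (LipschitzWith.of_dist_le_mul (K := (⟨K * B * ν.real Q, by positivity⟩ : NNReal))
      fun p p' => by rw [dist_eq_norm, dist_eq_norm]; exact hFL i p p').continuous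
  have hint : ∀ i, Integrable (fun p => (F i p - γ i p) ^ 2) (ν.restrict Q) := fun i => by
    refine Integrable.of_bound (((hFm i).measurable.sub (hγm i)).pow_const 2).aestronglyMeasurable
      ((2 * B) ^ 2) (Eventually.of_forall fun p => ?_)
    rw [norm_pow]
    have h1 := abs_le.1 (hFB i p); have h2 := abs_le.1 (hγB i p)
    exact pow_le_pow_left₀ (norm_nonneg _) (abs_le.2 ⟨by linarith, by linarith⟩) 2
  have hpt : ∀ p ∈ Q, (γ i p - γ j p) ^ 2 ≤
      3 * (F i p - γ i p) ^ 2 + 3 * (F j p - γ j p) ^ 2 + 3 * s ^ 2 := by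
    intro p hp
    have h1 : (F i p - F j p) ^ 2 ≤ s ^ 2 := by
      rw [← sq_abs]; exact pow_le_pow_left₀ (abs_nonneg _) (hij p hp) 2
    nlinarith [sq_nonneg ((F i p - γ i p) + (F j p - γ j p)),
      sq_nonneg ((F i p - γ i p) + (F i p - F j p)), sq_nonneg ((F j p - γ j p) - (F i p - F j p))]
  have hi1 := (hint i).const_mul 3
  have hi2 := (hint j).const_mul 3
  have hi12 : Integrable (fun p => 3 * (F i p - γ i p) ^ 2 + 3 * (F j p - γ j p) ^ 2)
    (ν.restrict Q) := hi1.add hi2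
  have hfin := integral_mono_of_nonneg (μ := ν.restrict Q) (Eventually.of_forall fun p =>
    sq_nonneg (γ i p - γ j p)) (hi12.add (integrable_const (3 * s ^ 2)))
    ((ae_restrict_iff' hQm).2 (Eventually.of_forall hpt))
  refine hfin.trans ?_
  simp only [Pi.add_apply]
  rw [integral_add hi12 (integrable_const _), integral_add hi1 hi2, integral_const_mul,
    integral_const_mul, setIntegral_const, smul_eq_mul]
  have hss : s ^ 2 = ε / 9 / (ν.real Q + 1) := Real.sq_sqrt (by positivity)
  have h4 : ν.real Q * s ^ 2 ≤ ε / 9 := by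
    have hν : 0 ≤ ν.real Q := measureReal_nonneg
    rw [hss, mul_div_assoc', div_le_iff₀ (by linarith)]
    nlinarith
  linarith [hFγ i, hFγ j]

end TotallyBounded

/-! ### `L²` norms and bounded representatives -/

lemma eLpNorm_two_eq {α : Type*} [MeasurableSpace α] {ν : Measure α} {g : α → ℝ}
    (hg : MemLp g 2 ν) : eLpNorm g 2 ν = ENNReal.ofReal (Real.sqrt (∫ p, g p ^ 2 ∂ν)) := by
  rw [hg.eLpNorm_eq_integral_rpow_norm (by norm_num) (by norm_num), Real.sqrt_eq_rpow]
  simp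

lemma memLp_two_of_abs_le_of_support {α : Type*} [MeasurableSpace α] {ν : Measure α} {g : α → ℝ}
    (hg : Measurable g) {C : ℝ} (hC : ∀ p, |g p| ≤ C) {s : Set α} (hs : ν s < ⊤)
    (h0 : ∀ p ∉ s, g p = 0) : MemLp g 2 ν := by
  rw [memLp_two_iff_integrable_sq hg.aestronglyMeasurable]
  refine integrable_of_abs_le_of_support (hg.pow_const 2) (C := C ^ 2) (fun p => ?_) hs
    fun p hp => by simp [h0 p hp]
  rw [abs_pow]
  exact pow_le_pow_left₀ (abs_nonneg _) (hC p) 2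

lemma memLp_two_translate_sub {γ : SpaceTime d → ℝ} (hγ : MemLp γ 2 volume) (q : SpaceTime d) :
    MemLp (fun p => γ (p + q) - γ p) 2 volume :=
  (hγ.comp_measurePreserving (measurePreserving_add_right volume q)).sub hγ

lemma eLpNorm_translate_sub_eq {g γ : SpaceTime d → ℝ} (h : g =ᵐ[volume] γ)
    (hγ : MemLp γ 2 volume) (q : SpaceTime d) :
    eLpNorm (fun p => g (p + q) - g p) 2 volume =
      ENNReal.ofReal (Real.sqrt (∫ p, (γ (p + q) - γ p) ^ 2)) := by
  rw [← eLpNorm_two_eq (memLp_two_translate_sub hγ q)]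
  refine eLpNorm_congr_ae ?_
  filter_upwards [h, (measurePreserving_add_right volume q).quasiMeasurePreserving.ae h]
    with p h1 h2
  rw [h1, h2]

/-- Translate in space, then in time, and use `(x+y)² ≤ 2x² + 2y²` with translation invariance. -/
lemma integral_sq_translate_le {γ : SpaceTime d → ℝ} (hγ : MemLp γ 2 volume) (q : SpaceTime d)
    {ε : ℝ} (h1 : ∫ p, (γ (p + (0, q.2)) - γ p) ^ 2 ≤ ε)
    (h2 : ∫ p, (γ (p + (q.1, 0)) - γ p) ^ 2 ≤ ε) : ∫ p, (γ (p + q) - γ p) ^ 2 ≤ 4 * ε := by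
  have i1 := (memLp_two_translate_sub hγ (0, q.2)).integrable_sq
  have i2 := ((memLp_two_translate_sub hγ (q.1, 0)).integrable_sq).comp_add_right (0, q.2)
  have h3 : ∫ p, (γ (p + (0, q.2) + (q.1, 0)) - γ (p + (0, q.2))) ^ 2 ≤ ε := by
    rwa [integral_add_right_eq_self (fun p => (γ (p + (q.1, 0)) - γ p) ^ 2)]
  have h4 := integral_mono_of_nonneg (μ := volume)
    (f := fun p => (γ (p + q) - γ p) ^ 2)
    (Eventually.of_forall fun p => sq_nonneg _) ((i1.const_mul 2).add (i2.const_mul 2))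
    (Eventually.of_forall fun p => by
      have : p + q = p + (0, q.2) + (q.1, 0) := by ext <;> simp
      simp only [this, Pi.add_apply]
      nlinarith [sq_nonneg ((γ (p + (0, q.2) + (q.1, 0)) - γ (p + (0, q.2))) -
        (γ (p + (0, q.2)) - γ p))])
  refine h4.trans ?_
  simp only [Pi.add_apply]
  rw [integral_add (i1.const_mul 2) (i2.const_mul 2), integral_const_mul, integral_const_mul]
  linarith

lemma ae_abs_le_toReal_eLpNorm {α : Type*} [MeasurableSpace α] {ν : Measure α} {g : α → ℝ}
    (hg : MemLp g ⊤ ν) : ∀ᵐ x ∂ν, |g x| ≤ (eLpNorm g ⊤ ν).toReal := by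
  have h := ae_le_eLpNormEssSup (f := g) (μ := ν)
  filter_upwards [h] with x hx
  rw [← eLpNorm_exponent_top] at hx
  have := ENNReal.toReal_mono hg.2.ne hx
  simpa using this

lemma measurable_indicator_of_continuousOn {α : Type*} [TopologicalSpace α] [MeasurableSpace α]
    [OpensMeasurableSpace α] {g : α → ℝ} {s : Set α} (hg : ContinuousOn g s)
    (hs : MeasurableSet s) : Measurable (s.indicator g) := by
  classical
  rw [← piecewise_eq_indicator]
  exact hg.measurable_piecewise continuousOn_const hs

/-- Bounded measurable representatives of `u` on `Q` and of `gammaFun`, vanishing off `Q`. -/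
lemma exists_representatives {T R B : ℝ} {Ω : Set (Space d)} (hΩo : IsOpen Ω) {b : ℝ → ℝ}
    (hb : Continuous b) (hR : 0 ≤ R) (hB : 0 ≤ B) (hbB : ∀ v, |v| ≤ R → |b v| ≤ B)
    {uc ubar : SpaceTime d → ℝ}
    (hubar : ContinuousOn ubar (Icc 0 T ×ˢ univ))
    (hubarR : ∀ p ∈ Icc 0 T ×ˢ (univ : Set (Space d)), |ubar p| ≤ R)
    (huc : EqOn ubar uc (extCyl T Ω)) {u : SpaceTime d → ℝ}
    (hum : AEStronglyMeasurable u (volume.restrict (slab d T)))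
    (huR : ∀ᵐ p ∂(volume.restrict (slab d T)), |u p| ≤ R)
    (hext : ∀ᵐ p ∂(volume.restrict (extCyl T Ω)), u p = uc p) :
    ∃ U γ : SpaceTime d → ℝ, Measurable U ∧ Measurable γ ∧ (∀ p, |U p| ≤ R) ∧
      (∀ p, |γ p| ≤ 2 * B) ∧ (∀ p ∉ cyl T Ω, U p = 0) ∧ (∀ p ∉ cyl T Ω, γ p = 0) ∧
      (∀ p ∈ cyl T Ω, γ p = b (U p) - b (ubar p)) ∧
      (∀ᵐ p ∂(volume.restrict (cyl T Ω)), U p = u p) ∧ gammaFun T b ubar u =ᵐ[volume] γ := by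
  have hmc := measurableSet_cyl T hΩo
  have hsub : cyl T Ω ⊆ Icc 0 T ×ˢ (univ : Set (Space d)) := fun p hp =>
    ⟨Ioo_subset_Icc_self hp.1, mem_univ _⟩
  set g := hum.mk u with hg
  have hgm : Measurable g := hum.stronglyMeasurable_mk.measurable
  -- Clipping turns the a.e. bound into one valid everywhere and, by the maximum principle, changes
  -- `u` only on a null subset of `Q`.
  set U : SpaceTime d → ℝ := (cyl T Ω).indicator fun p => max (-R) (min (g p) R) with hU
  have hUm : Measurable U :=
    (measurable_const.max (hgm.min measurable_const)).indicator hmc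
  have hUR : ∀ p, |U p| ≤ R := by
    intro p
    by_cases hp : p ∈ cyl T Ω
    · rw [hU, indicator_of_mem hp]
      exact abs_le.2 ⟨le_max_left _ _, max_le (by linarith) (min_le_right _ _)⟩
    · rw [hU, indicator_of_notMem hp, abs_zero]; exact hR
  have hUu : ∀ᵐ p ∂(volume.restrict (cyl T Ω)), U p = u p := by
    filter_upwards [ae_restrict_of_ae_restrict_of_subset (cyl_subset_slab T Ω) hum.ae_eq_mk,
      ae_restrict_of_ae_restrict_of_subset (cyl_subset_slab T Ω) huR, ae_restrict_mem hmc]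
      with p h1 h2 hp
    rw [abs_le] at h2
    rw [hU, indicator_of_mem hp, hg, ← h1, min_eq_left h2.2, max_eq_right h2.1]
  set γ : SpaceTime d → ℝ := fun p => (cyl T Ω).indicator (fun p => b (U p)) p -
    (cyl T Ω).indicator (fun p => b (ubar p)) p with hγ
  have hγm : Measurable γ := ((hb.measurable.comp hUm).indicator hmc).sub
    (measurable_indicator_of_continuousOn (hb.comp_continuousOn (hubar.mono hsub)) hmc)
  have hγ1 : ∀ p ∈ cyl T Ω, γ p = b (U p) - b (ubar p) := fun p hp => by
    simp only [hγ]; rw [indicator_of_mem hp, indicator_of_mem hp]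
  have hγ0 : ∀ p ∉ cyl T Ω, γ p = 0 := fun p hp => by
    simp only [hγ]; rw [indicator_of_notMem hp, indicator_of_notMem hp, sub_zero]
  refine ⟨U, γ, hUm, hγm, hUR, fun p => ?_, fun p hp => indicator_of_notMem hp _, hγ0, hγ1, hUu, ?_⟩
  · by_cases hp : p ∈ cyl T Ω
    · rw [hγ1 p hp]
      have h1 := abs_le.1 (hbB _ (hUR p))
      have h2 := abs_le.1 (hbB _ (hubarR p (hsub hp)))
      exact abs_le.2 ⟨by linarith, by linarith⟩
    · rw [hγ0 p hp, abs_zero]; positivity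
  · filter_upwards [(ae_restrict_iff' hmc).1 hUu,
      (ae_restrict_iff' (measurableSet_extCyl T hΩo)).1 hext] with p h1 h2
    by_cases hps : p ∈ slab d T
    · rw [gammaFun, indicator_of_mem hps]
      by_cases hp : p ∈ cyl T Ω
      · rw [hγ1 p hp, h1 hp]
      · have hpe : p ∈ extCyl T Ω := ⟨hps.1, fun h => hp ⟨hps.1, h⟩⟩
        rw [hγ0 p hp, h2 hpe, huc hpe, sub_self]
    · rw [gammaFun, indicator_of_notMem hps, hγ0 p fun h => hps (cyl_subset_slab T Ω h)]

lemma isCompact_closure_range_toLp {α : Type*} [MeasurableSpace α] {ν : Measure α} {F : ℕ → α → ℝ}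
    (hF : ∀ n, MemLp (F n) 2 ν) (h : ∀ ε > 0, ∃ t : Set ℕ, t.Finite ∧ ∀ i, ∃ j ∈ t,
      ∫ p, (F i p - F j p) ^ 2 ∂ν ≤ ε) :
    IsCompact (closure (range fun n => (hF n).toLp (F n))) := by
  refine isCompact_iff_totallyBounded_isComplete.2
    ⟨TotallyBounded.closure ?_, isClosed_closure.isComplete⟩
  refine Metric.totallyBounded_iff.2 fun ε hε => ?_
  obtain ⟨t, htf, ht⟩ := h ((ε / 2) ^ 2) (by positivity)
  refine ⟨(fun n => (hF n).toLp (F n)) '' t, htf.image _, ?_⟩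
  rintro _ ⟨i, rfl⟩
  obtain ⟨j, hj, hij⟩ := ht i
  refine mem_iUnion₂.2 ⟨_, mem_image_of_mem _ hj, ?_⟩
  have hm : MemLp (fun p => F i p - F j p) 2 ν := (hF i).sub (hF j)
  have hd : dist ((hF i).toLp (F i)) ((hF j).toLp (F j)) =
      (eLpNorm (fun p => F i p - F j p) 2 ν).toReal := by
    rw [dist_eq_norm, ← MemLp.toLp_sub, Lp.norm_toLp]; rfl
  rw [Metric.mem_ball]
  simp only
  rw [hd, eLpNorm_two_eq hm, ENNReal.toReal_ofReal (Real.sqrt_nonneg _)]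
  have : Real.sqrt (∫ p, (F i p - F j p) ^ 2 ∂ν) ≤ ε / 2 :=
    Real.sqrt_le_iff.2 ⟨by positivity, hij⟩
  linarith

lemma continuous_of_lipschitzOnWith_Icc {f : ℝ → Space d} {Lf : ℝ → ℝ≥0}
    (hf : ∀ R : ℝ, LipschitzOnWith (Lf R) f (Icc (-R) R)) : Continuous f := by
  refine continuous_iff_continuousAt.2 fun x => ?_
  refine (hf (|x| + 1)).continuousOn.continuousAt (Icc_mem_nhds ?_ ?_)
  · linarith [neg_abs_le x]
  · linarith [le_abs_self x]

end NonlocalCL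

/-! ### The theorem -/

theorem proposition4p1 {d : ℕ} (hd : 1 ≤ d) (T : ℝ) (hT : 0 < T)
    -- the domain
    (Ω : Set (NonlocalCL.Space d)) (hΩo : IsOpen Ω) (hΩb : Bornology.IsBounded Ω)
    (hΩ : NonlocalCL.HasC2Boundary Ω)
    -- the convective flux, with Lipschitz constants on the intervals `[-R,R]`
    (f : ℝ → NonlocalCL.Space d) (Lf : ℝ → ℝ≥0)
    (hf : ∀ R : ℝ, LipschitzOnWith (Lf R) f (Icc (-R) R))
    -- the diffusive flux
    (b : ℝ → ℝ) (hb : LocallyLipschitz b) (hbm : Monotone b) (hb' : NonlocalCL.HasLocBVDeriv b)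
    -- exterior data and its extension
    (uc ubar : NonlocalCL.SpaceTime d → ℝ)
    (hubar : ContDiffOn ℝ 2 ubar (Icc 0 T ×ˢ univ))
    (hubar_bdd : ∃ C : ℝ, ∀ p ∈ Icc 0 T ×ˢ (univ : Set (NonlocalCL.Space d)), |ubar p| ≤ C)
    (huc : EqOn ubar uc (NonlocalCL.extCyl T Ω))
    -- initial data
    (u₀ : NonlocalCL.Space d → ℝ) (hu₀ : MemLp u₀ ⊤ (volume.restrict Ω))
    -- the Lévy measures
    (μ : Measure (NonlocalCL.Space d)) (hμ : NonlocalCL.IsSymmLevy μ)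
    (μs : ℕ → Measure (NonlocalCL.Space d)) (hμs : ∀ n, NonlocalCL.IsSymmLevy (μs n))
    (hlim : Tendsto (fun n => NonlocalCL.levyDist (μs n) μ) atTop (𝓝 0))
    -- the entropy solutions
    (u : ℕ → NonlocalCL.SpaceTime d → ℝ)
    (hu : ∀ n, NonlocalCL.IsEntropySolution T Ω f Lf b uc ubar u₀ (μs n) (u n))
    -- equicontinuity with respect to translations in space
    (hspace : Tendsto (fun h : NonlocalCL.Space d =>
      ⨆ n, eLpNorm (fun p : NonlocalCL.SpaceTime d =>
        NonlocalCL.gammaFun T b ubar (u n) (p.1, p.2 + h)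
          - NonlocalCL.gammaFun T b ubar (u n) p) 2 volume) (𝓝 0) (𝓝 0)) :
    Tendsto (fun τ : ℝ =>
      ⨆ n, eLpNorm (fun p : NonlocalCL.SpaceTime d =>
        NonlocalCL.gammaFun T b ubar (u n) (p.1 + τ, p.2)
          - NonlocalCL.gammaFun T b ubar (u n) p) 2 volume) (𝓝 0) (𝓝 0) ∧
    ∃ hL2 : ∀ n, MemLp (fun p => b (u n p)) 2 (volume.restrict (NonlocalCL.cyl T Ω)),
      IsCompact (closure (Set.range fun n => (hL2 n).toLp (fun p => b (u n p)))) := by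
  open NonlocalCL in
  obtain ⟨M, hM⟩ := exists_levyMass_le hμ hμs hlim
  obtain ⟨C, hC⟩ := hubar_bdd
  set R₀ := max |C| (eLpNorm u₀ ⊤ (volume.restrict Ω)).toReal with hR₀
  -- The margin makes `|u n| < R` strict, so that `u n` never meets the levels `k = ±R` of the
  -- linearised entropy inequality.
  set R := R₀ + 1 with hR
  have hR₀0 : 0 ≤ R₀ := (abs_nonneg C).trans (le_max_left _ _)
  have hRpos : 0 < R := by linarith
  have hCR : C ≤ R₀ := (le_abs_self C).trans (le_max_left _ _)
  have hslabIcc : slab d T ⊆ Icc 0 T ×ˢ (univ : Set (Space d)) := fun p hp =>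
    ⟨Ioo_subset_Icc_self hp.1, mem_univ _⟩
  have huR₀ : ∀ n, ∀ᵐ p ∂(volume.restrict (slab d T)), |u n p| ≤ R₀ := fun n =>
    (hu n).ae_abs_le hΩo hΩb hbm (hμs n)
      (fun p hp => by
        rw [← huc hp]
        exact (hC p (hslabIcc ⟨hp.1, mem_univ _⟩)).trans hCR)
      (fun p hp => (hC p (hslabIcc hp)).trans hCR)
      ((ae_abs_le_toReal_eLpNorm hu₀).mono fun x hx => hx.trans (le_max_right _ _))
  have hfc : Continuous f := continuous_of_lipschitzOnWith_Icc hf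
  have hF : ∀ v w, |v| ≤ R → |w| ≤ R → ‖f v - f w‖ ≤ Lf R * (2 * R) := by
    intro v w hv hw
    have h1 := (hf R).dist_le_mul v (abs_le.1 hv) w (abs_le.1 hw)
    rw [dist_eq_norm, Real.dist_eq] at h1
    refine h1.trans (mul_le_mul_of_nonneg_left ?_ (NNReal.coe_nonneg _))
    rw [abs_le] at hv hw ⊢
    constructor <;> linarith
  obtain ⟨B, hB⟩ := isCompact_Icc.exists_bound_of_continuousOn (s := Icc (-R) R)
    hb.continuous.continuousOn
  have hbB : ∀ v, |v| ≤ R → |b v| ≤ B := fun v hv => hB v (abs_le.1 hv)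
  have hB0 : 0 ≤ B := (abs_nonneg _).trans (hbB 0 (by simpa using hRpos.le))
  obtain ⟨L, hL⟩ := (hb.locallyLipschitzOn (s := Icc (-R) R)).exists_lipschitzOnWith_of_compact
    isCompact_Icc
  have hbL : ∀ v w, |v| ≤ R → |w| ≤ R → |b v - b w| ≤ L * |v - w| := fun v w hv hw =>
    hL.dist_le_mul v (abs_le.1 hv) w (abs_le.1 hw)
  have hrep := fun n => exists_representatives hΩo hb.continuous hRpos.le hB0 hbB
    hubar.continuousOn (fun p hp => (hC p hp).trans (by linarith)) huc (hu n).memLp.1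
    ((huR₀ n).mono fun p hp => by linarith) (hu n).exterior
  choose U γ hUm hγm hUR hγB hU0 hγ0 hγU hUu hγe using hrep
  have hQ := volume_cyl_lt_top T hΩb
  have hγ2 : ∀ n, MemLp (γ n) 2 volume := fun n =>
    memLp_two_of_abs_le_of_support (hγm n) (hγB n) hQ (hγ0 n)
  have hshift : ∀ n (q : SpaceTime d), eLpNorm (fun p : SpaceTime d =>
      gammaFun T b ubar (u n) (p + q) - gammaFun T b ubar (u n) p) 2 volume =
      ENNReal.ofReal (Real.sqrt (∫ p, (γ n (p + q) - γ n p) ^ 2)) := fun n q =>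
    eLpNorm_translate_sub_eq (hγe n) (hγ2 n) q
  have hspq : ∀ (p : SpaceTime d) (h : Space d), (p.1, p.2 + h) = p + (0, h) := fun p h => by
    ext <;> simp
  have htq : ∀ (p : SpaceTime d) (τ : ℝ), (p.1 + τ, p.2) = p + (τ, 0) := fun p τ => by
    ext <;> simp
  simp only [hspq, hshift] at hspace
  have hsp : ∀ ε > 0, ∃ η > 0, ∀ h : Space d, ‖h‖ < η →
      ∀ i, ∫ p, (γ i (p + (0, h)) - γ i p) ^ 2 ≤ ε ^ 2 := by
    intro ε hε
    obtain ⟨η, hη, hηh⟩ := Metric.eventually_nhds_iff.1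
      (hspace.eventually_lt_const (ENNReal.ofReal_pos.2 hε))
    refine ⟨η, hη, fun h hh i => ?_⟩
    have h1 := (le_iSup (fun n => ENNReal.ofReal
      (Real.sqrt (∫ p, (γ n (p + (0, h)) - γ n p) ^ 2))) i).trans (hηh (by simpa using hh)).le
    rw [ENNReal.ofReal_le_ofReal_iff hε.le] at h1
    exact (Real.sqrt_le_left hε.le).1 h1
  have havg : ∀ δ > 0, ∃ ρ : Space d → ℝ, Continuous ρ ∧ Integrable ρ ∧ (∀ x, 0 ≤ ρ x) ∧
      ∫ x, ρ x = 1 ∧ (∀ x, δ ≤ ‖x‖ → ρ x = 0) ∧ ∃ K, 0 ≤ K ∧ ∀ i x₀,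
        (∀ y ∉ Ω, ρ (y - x₀) = 0) → ∀ τ : ℝ, ∀ᵐ t : ℝ, t ∈ Ioo 0 T → t + τ ∈ Ioo 0 T →
        |(∫ y, U i (t + τ, y) * ρ (y - x₀)) - ∫ y, U i (t, y) * ρ (y - x₀)| ≤ K * |τ| := by
    intro δ hδ
    let φ : ContDiffBump (0 : Space d) := ⟨δ / 2, δ, by positivity, by linarith⟩
    obtain ⟨K, hK0, hK⟩ := exists_time_lipschitz_average (Lf := Lf) (uc := uc) (ubar := ubar)
      (u₀ := u₀) (M := M) hT hΩo hΩb hfc hRpos hB0 hF hbB (φ.contDiff_normed (μ := volume) (n := ⊤))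
      φ.hasCompactSupport_normed φ.nonneg_normed
    refine ⟨φ.normed volume, φ.continuous_normed, φ.integrable_normed, φ.nonneg_normed,
      φ.integral_normed, fun x hx => ?_, K, hK0, fun i x₀ hx₀ τ => ?_⟩
    · have : x ∉ Function.support (φ.normed volume) := by
        rw [φ.support_normed_eq, Metric.mem_ball, dist_zero_right]
        exact not_lt.2 hx
      simpa using this
    · exact hK (μs i) (u i) (U i) (hμs i) (hM i) (hu i)
        ((huR₀ i).mono fun p hp => by linarith) (hUm i) (hUR i) (hUu i) (hU0 i) x₀ hx₀ τ
  have htime := exists_integral_sq_time_translate_le hT hΩo hΩb hRpos.le (NNReal.coe_nonneg L)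
    (by positivity) hbm hbL (hb.continuous.comp_continuousOn hubar.continuousOn) hUm hγm hUR hγB
    hU0 hγ0 hγU hsp havg
  refine ⟨?_, ?_⟩
  · simp only [htq, hshift]
    refine ENNReal.tendsto_nhds_zero.2 fun ε hε => ?_
    rcases eq_or_ne ε ⊤ with rfl | hεt
    · exact Eventually.of_forall fun _ => le_top
    have he : 0 < ε.toReal := ENNReal.toReal_pos hε.ne' hεt
    obtain ⟨η, hη, hητ⟩ := htime (ε.toReal ^ 2) (by positivity)
    filter_upwards [Metric.ball_mem_nhds (0 : ℝ) hη] with τ hτ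
    refine iSup_le fun n => ?_
    rw [← ENNReal.ofReal_toReal hεt]
    exact ENNReal.ofReal_le_ofReal (Real.sqrt_le_iff.2
      ⟨he.le, hητ τ (by simpa using hτ) n⟩)
  · have hmc := measurableSet_cyl T hΩo
    have hL2 : ∀ n, MemLp (fun p => b (u n p)) 2 (volume.restrict (cyl T Ω)) := by
      intro n
      have : IsFiniteMeasure (volume.restrict (cyl T Ω)) := isFiniteMeasure_restrict.2 hQ.ne
      refine MemLp.of_bound (hb.continuous.comp_aestronglyMeasurable
        ((hu n).memLp.1.mono_measure (Measure.restrict_mono (cyl_subset_slab T Ω) le_rfl))) B ?_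
      filter_upwards [ae_restrict_of_ae_restrict_of_subset (cyl_subset_slab T Ω) (huR₀ n)] with p hp
      exact hbB _ (by linarith)
    refine ⟨hL2, isCompact_closure_range_toLp hL2 fun ε hε => ?_⟩
    have hjoint : ∀ ε > 0, ∃ η > 0, ∀ q : SpaceTime d, ‖q‖ < η → ∀ i,
        ∫ p, (γ i (p + q) - γ i p) ^ 2 ≤ ε := by
      intro ε hε
      obtain ⟨η₁, hη₁, h1⟩ := hsp (Real.sqrt (ε / 4)) (by positivity)
      obtain ⟨η₂, hη₂, h2⟩ := htime (ε / 4) (by positivity)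
      refine ⟨min η₁ η₂, by positivity, fun q hq i => ?_⟩
      have h3 := h1 q.2 ((norm_snd_le q).trans_lt (hq.trans_le (min_le_left _ _))) i
      rw [Real.sq_sqrt (by positivity)] at h3
      have h4 := h2 q.1 ((norm_fst_le q).trans_lt (hq.trans_le (min_le_right _ _))) i
      exact (integral_sq_translate_le (hγ2 i) q h3 h4).trans (by linarith)
    obtain ⟨t, htf, ht⟩ := exists_finite_net_of_translate hγm hγB hmc
      (Metric.isBounded_Ioo 0 T |>.prod hΩb) hγ0 hjoint ε hε
    refine ⟨t, htf, fun i => ?_⟩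
    obtain ⟨j, hj, hij⟩ := ht i
    -- The common term `b(ubar)` cancels in `γ i - γ j`, so a net for the `γ n` is one for the `b(u
    -- n)`.
    refine ⟨j, hj, (le_of_eq (integral_congr_ae ?_)).trans hij⟩
    filter_upwards [hUu i, hUu j, ae_restrict_mem hmc] with p h1 h2 hp
    rw [hγU i p hp, hγU j p hp, h1, h2]
    ring
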